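/- Let $\Lambda\subset\{1,2,3,\dots\}$. The ladder $\Gamma_\Lambda$ is the simple unweighted graph whose vertices are $u_n,v_n$ ($n\ge1$) and whose edges are $\{u_n,u_{n+1}\}$ and $\{v_n,v_{n+1}\}$ for all $n\ge1$, together with the rungs $\{u_n,v_n\}$ for $n\in\Lambda$. Let $A(\Gamma_\Lambda)$ be its adjacency operator, the bounded operator on $\ell^2$ of the vertex set given by $(Af)(x)=\sum_{y\sim x}f(y)$; let $\sigma$ be its spectrum, $\sigma_p$ the set of all its eigenvalues, and $\sigma_{ess}=\sigma\setminus\sigma_d$ its essential spectrum, where $\sigma_d$ is the set of isolated points of $\sigma$ that are eigenvalues of finite multiplicity. Then: (1) (infinite linear hexagon) If $\Lambda=\{1,3,5,\dots\}$, then $$\sigma(\Gamma_\Lambda)=\sigma_{ess}(\Gamma_\Lambda)=\Bigl[\frac{-1-\sqrt{17}}2,\ \frac{1+\sqrt{17}}2\Bigr],\qquad \sigma_p(\Gamma_\Lambda)=\emptyset.$$ (2) (infinite linear octagon) If $\Lambda=\{1,4,7,\dots\}$, then $$\sigma(\Gamma_\Lambda)=\bigl[-1-\sqrt2,\ 1+\sqrt2\bigr]\cup\Bigl\{\pm\frac{1+\sqrt5}2\Bigr\},\qquad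 \sigma_p(\Gamma_\Lambda)=\Bigl\{\pm\frac{1+\sqrt5}2\Bigr\}$$ (the two eigenvalues lie inside the interval). Moreover the spectrum has multiplicity $2$ on $[1-\sqrt2,\sqrt2-1]$ and multiplicity $1$ off this interval. Here a bounded selfadjoint operator on a separable Hilbert space has spectral multiplicity $k$ on $S\subset\mathbb{R}$ if it is unitarily equivalent to multiplication by the independent variable on $\bigoplus_{n\ge0}L^2(\{x: n<m(x)\},\mu)$ for some finite Borel measure $\mu$ on $\mathbb{R}$ and some measurable $m:\mathbb{R}\to\{0,1,2,\dots,\infty\}$ with $m\ge1$ $\mu$-almost everywhere and $m=k$ $\mu$-almost everywhere on $S$. -/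

import Mathlib

open Set MeasureTheory
open scoped ENNReal

/-- The Hilbert space `ℓ²(V)` of square summable complex functions on `V`. -/
abbrev EllTwo (V : Type*) : Type _ := lp (fun _ : V => ℂ) 2

theorem adjacency_sum_le {V : Type*} (G : SimpleGraph V) [G.LocallyFinite] (d : ℕ)
    (hd : ∀ v, G.degree v ≤ d) (f : EllTwo V) (s : Finset V) :
    ∑ v ∈ s, ‖∑ u ∈ G.neighborFinset v, f u‖ ^ (2 : ℝ≥0∞).toReal
      ≤ (d * ‖f‖) ^ (2 : ℝ≥0∞).toReal := by
  classical
  have h2 : (2 : ℝ≥0∞).toReal = ((2 : ℕ) : ℝ) := by simp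
  have hf : ∀ t : Finset V, ∑ u ∈ t, ‖f u‖ ^ 2 ≤ ‖f‖ ^ 2 := by
    intro t
    have h := lp.sum_rpow_le_norm_rpow (p := 2) (by simp) f t
    simpa only [h2, Real.rpow_natCast] using h
  simp only [h2, Real.rpow_natCast]
  have h1 : ∀ v ∈ s, ‖∑ u ∈ G.neighborFinset v, f u‖ ^ 2
      ≤ d * ∑ u ∈ G.neighborFinset v, ‖f u‖ ^ 2 := by
    intro v _
    calc ‖∑ u ∈ G.neighborFinset v, f u‖ ^ 2
        ≤ (∑ u ∈ G.neighborFinset v, ‖f u‖) ^ 2 := by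
          gcongr
          exact norm_sum_le _ _
      _ ≤ (G.neighborFinset v).card * ∑ u ∈ G.neighborFinset v, ‖f u‖ ^ 2 :=
          sq_sum_le_card_mul_sum_sq
      _ ≤ d * ∑ u ∈ G.neighborFinset v, ‖f u‖ ^ 2 := by
          gcongr
          rw [G.card_neighborFinset_eq_degree]
          exact hd v
  have h3 : ∑ v ∈ s, ∑ u ∈ G.neighborFinset v, ‖f u‖ ^ 2 ≤ d * ‖f‖ ^ 2 := by
    rw [Finset.sum_comm' (t' := s.biUnion fun v => G.neighborFinset v)
      (s' := fun u => s.filter fun v => G.Adj v u)]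
    · calc ∑ u ∈ s.biUnion fun v => G.neighborFinset v,
            ∑ v ∈ s.filter fun v => G.Adj v u, ‖f u‖ ^ 2
          ≤ ∑ u ∈ s.biUnion fun v => G.neighborFinset v, (d : ℝ) * ‖f u‖ ^ 2 := by
            refine Finset.sum_le_sum fun u _ => ?_
            rw [Finset.sum_const, nsmul_eq_mul]
            gcongr
            refine le_trans (Finset.card_le_card (t := G.neighborFinset u) ?_) ?_
            · intro v hv
              simpa using (Finset.mem_filter.mp hv).2.symm
            · rw [G.card_neighborFinset_eq_degree]
              exact hd u
        _ ≤ d * ‖f‖ ^ 2 := by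
            rw [← Finset.mul_sum]
            gcongr
            exact hf _
    · intro v u
      simp only [Finset.mem_filter, Finset.mem_biUnion, SimpleGraph.mem_neighborFinset]
      constructor
      · rintro ⟨a, b⟩
        exact ⟨⟨a, b⟩, v, a, b⟩
      · rintro ⟨⟨a, b⟩, _⟩
        exact ⟨a, b⟩
  calc ∑ v ∈ s, ‖∑ u ∈ G.neighborFinset v, f u‖ ^ 2
      ≤ ∑ v ∈ s, d * ∑ u ∈ G.neighborFinset v, ‖f u‖ ^ 2 := Finset.sum_le_sum h1
    _ = d * ∑ v ∈ s, ∑ u ∈ G.neighborFinset v, ‖f u‖ ^ 2 := by rw [Finset.mul_sum]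
    _ ≤ d * (d * ‖f‖ ^ 2) := by gcongr
    _ = (d * ‖f‖) ^ 2 := by ring

/-- The adjacency operator of a uniformly locally finite (unweighted) graph `G`: the bounded
operator on `ℓ²(V)` given by `(A f)(v) = ∑_{u ∼ v} f(u)`. -/
noncomputable def adjacencyOperator {V : Type*} (G : SimpleGraph V) [G.LocallyFinite]
    (hG : ∃ d : ℕ, ∀ v, G.degree v ≤ d) : EllTwo V →L[ℂ] EllTwo V :=
  LinearMap.mkContinuousOfExistsBound
    { toFun := fun f => ⟨fun v => ∑ u ∈ G.neighborFinset v, f u,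
        memℓp_gen' (adjacency_sum_le G hG.choose hG.choose_spec f)⟩
      map_add' := fun f g => by
        ext v
        exact Finset.sum_add_distrib
      map_smul' := fun c f => by
        ext v
        simp [Finset.mul_sum] }
    ⟨hG.choose, fun f => lp.norm_le_of_forall_sum_le (by simp) (by positivity)
      (adjacency_sum_le G hG.choose hG.choose_spec f)⟩

/-- Simon's ladder with rungs at the positions in `Λ ⊆ {1, 2, 3, …}`. The vertices `(n, false)` and
`(n, true)`, `n = 0, 1, 2, …`, are the two vertices at position `n + 1` of the ladder, on its two
rails. Both rails are one-sided infinite paths, and the two vertices at a position are joined by a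
rung exactly when the position belongs to `Λ`. -/
def simonLadder (Λ : Set ℕ) : SimpleGraph (ℕ × Bool) where
  Adj u v := (u.2 = v.2 ∧ (u.1 + 1 = v.1 ∨ v.1 + 1 = u.1)) ∨
    (u.1 = v.1 ∧ u.2 ≠ v.2 ∧ u.1 + 1 ∈ Λ)
  symm := ⟨by
    rintro u v (⟨h, h'⟩ | ⟨h, h', h''⟩)
    · exact Or.inl ⟨h.symm, h'.symm⟩
    · exact Or.inr ⟨h.symm, h'.symm, h ▸ h''⟩⟩
  loopless := ⟨by
    rintro u (⟨_, h | h⟩ | ⟨_, h, _⟩)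
    · omega
    · omega
    · exact h rfl⟩

theorem simonLadder_neighborSet_subset (Λ : Set ℕ) (v : ℕ × Bool) :
    (simonLadder Λ).neighborSet v ⊆
      (({(v.1 + 1, v.2), (v.1 - 1, v.2), (v.1, !v.2)} : Finset (ℕ × Bool)) : Set (ℕ × Bool)) := by
  rintro ⟨n, b⟩ (⟨h, h' | h'⟩ | ⟨h, h', _⟩)
  · simp_all
  · have : n = v.1 - 1 := by simp at h'; omega
    simp_all
  · have : b = !v.2 := by
      revert h'
      cases b <;> cases v.2 <;> simp
    simp_all

noncomputable instance simonLadderLocallyFinite (Λ : Set ℕ) : (simonLadder Λ).LocallyFinite :=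
  fun v => ((Finset.finite_toSet _).subset (simonLadder_neighborSet_subset Λ v)).fintype

theorem simonLadder_degree_le (Λ : Set ℕ) : ∃ d : ℕ, ∀ v, (simonLadder Λ).degree v ≤ d := by
  refine ⟨3, fun v => ?_⟩
  rw [← SimpleGraph.card_neighborFinset_eq_degree]
  refine le_trans (Finset.card_le_card (t := {(v.1 + 1, v.2), (v.1 - 1, v.2), (v.1, !v.2)}) ?_)
    Finset.card_le_three
  intro u hu
  have hu' : u ∈ (simonLadder Λ).neighborSet v := by simpa using hu
  exact_mod_cast simonLadder_neighborSet_subset Λ v hu'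

/-- The adjacency operator of Simon's ladder with rung set `Λ`. -/
noncomputable def simonLadderOperator (Λ : Set ℕ) : EllTwo (ℕ × Bool) →L[ℂ] EllTwo (ℕ × Bool) :=
  adjacencyOperator (simonLadder Λ) (simonLadder_degree_le Λ)

/-- The point spectrum: the set of all eigenvalues. -/
def pointSpectrum {H : Type*} [NormedAddCommGroup H] [InnerProductSpace ℂ H]
    (T : H →L[ℂ] H) : Set ℂ :=
  {z | Module.End.HasEigenvalue (T : H →ₗ[ℂ] H) z}

/-- The discrete spectrum: the isolated points of the spectrum that are eigenvalues of finite
multiplicity. -/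
def discreteSpectrum {H : Type*} [NormedAddCommGroup H] [InnerProductSpace ℂ H]
    (T : H →L[ℂ] H) : Set ℂ :=
  {z | z ∈ pointSpectrum T ∧
    FiniteDimensional ℂ (Module.End.eigenspace (T : H →ₗ[ℂ] H) z) ∧
    ∃ O : Set ℂ, IsOpen O ∧ O ∩ spectrum ℂ T = {z}}

/-- The essential spectrum: the complement of the discrete spectrum in the spectrum. -/
def essentialSpectrum {H : Type*} [NormedAddCommGroup H] [InnerProductSpace ℂ H]
    (T : H →L[ℂ] H) : Set ℂ :=
  spectrum ℂ T \ discreteSpectrum T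

/-- Hahn–Hellinger form of a bounded selfadjoint operator `T` on a separable Hilbert space: a
unitary operator from `H` onto `⨁ₙ L²({x | n < m x}, μ)`, `n = 0, 1, 2, …`, carries `T` to
multiplication by the independent variable. Here `μ` is a scalar spectral measure of `T`, unique up
to mutual absolute continuity, and `m` is the spectral multiplicity function of `T`, unique up to a
`μ`-null set. -/
def IsHahnHellingerForm {H : Type*} [NormedAddCommGroup H] [InnerProductSpace ℂ H]
    (T : H →L[ℂ] H) (μ : Measure ℝ) (m : ℝ → ℕ∞) : Prop :=
  IsFiniteMeasure μ ∧ (∀ n : ℕ, MeasurableSet {x | (n : ℕ∞) < m x}) ∧ (∀ᵐ x ∂μ, 1 ≤ m x) ∧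
    ∃ U : H ≃ₗᵢ[ℂ] lp (fun n : ℕ => Lp ℂ 2 (μ.restrict {x | (n : ℕ∞) < m x})) 2,
      ∀ (f : H) (n : ℕ),
        ∀ᵐ x ∂(μ.restrict {x | (n : ℕ∞) < m x}), U (T f) n x = (x : ℂ) * U f n x

/-- The spectrum of `T` has multiplicity `k` on the set `S`: the multiplicity function of `T` equals
`k` almost everywhere on `S` with respect to the spectral measure of `T`. -/
def HasSpectralMultiplicityOn {H : Type*} [NormedAddCommGroup H] [InnerProductSpace ℂ H]
    (T : H →L[ℂ] H) (k : ℕ∞) (S : Set ℝ) : Prop :=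
  ∃ (μ : Measure ℝ) (m : ℝ → ℕ∞), IsHahnHellingerForm T μ m ∧ ∀ᵐ x ∂μ, x ∈ S → m x = k

/-! ### Polynomials as test functions for bounded measurable functions and finite measures -/

section PolynomialApproximation

open Polynomial

/-! The swap of the two rails splits the ladder operator into two half-line Jacobi matrices, for `ε
= 1` and `ε = -1`, with off-diagonal entries `1` and diagonal `ε` at rung positions, `0` elsewhere
(`isJacobiChain_ladder`). Each block is cyclic, so everything is read off from its spectral measure
`μ` at the first vector, whose orthonormal polynomials `p n` obey the three-term recursion.

For a diagonal of period `r + 1` with discriminant `d`, periodicity gives `p ((r+1)k + r) = p r * S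
k (d)`, with `S k` the Chebyshev polynomials orthonormal for the semicircle law. Orthonormality of
the `p n` then says that `d` pushes `(p r)² μ` forward to the semicircle law
(`IsPeriodicSpectralMeasure.map_withDensity`). Hence, off the zeros of `p r`, `μ` lives on the bands
`d⁻¹[-2, 2]` and does not charge Lebesgue null sets. Conversely a `μ`-null subset of a band is
Lebesgue null (`volume_eq_zero_of_measure`): the divided difference of `d` has top term `p r` and
lower terms orthogonal to `p r` times any function of `d`, which separates the branches of `d⁻¹`. No
density formula and no limiting process is needed. So the spectrum contains the bands, and it is
contained in any nonempty closed set containing the bands and the zeros of `p r`; for both ladders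
the bands of the two blocks together fill an interval that contains those zeros.

Eigenvectors give decaying solutions `g` of the recursion. The Casoratian of `g` and its translate
by one period is constant, so decay forces `g r = 0`, and then `g` is multiplied by a fixed factor
of modulus less than `1` over each period. For the hexagon that factor is `-1`; for the octagon
exactly one root survives for each `ε`.

For the multiplicity, two cyclic blocks with measures `μ`, `ν` have multiplicity `2` where both
densities with respect to `μ + ν` are nonzero and `1` elsewhere
(`isHahnHellingerForm_of_isJacobiChain`). On `[1-√2, √2-1]` both octagon measures are equivalent to
Lebesgue measure; outside it, the bands of the two blocks share only finitely many points. -/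

theorem Polynomial.submodule_eq_top_of_X_mul_mem {W : Submodule ℝ ℝ[X]} (h1 : 1 ∈ W)
    (hX : ∀ P ∈ W, X * P ∈ W) : W = ⊤ := by
  rw [eq_top_iff]
  rintro P -
  induction P using Polynomial.induction_on' with
  | add P Q hP hQ => exact W.add_mem hP hQ
  | monomial n c =>
    rw [← mul_one c, ← smul_eq_mul, ← Polynomial.smul_monomial]
    refine W.smul_mem _ ?_
    rw [← Polynomial.X_pow_eq_monomial]
    induction n with
    | zero => simpa using h1
    | succ n ih => rw [pow_succ']; exact hX _ ih

theorem integrable_polynomial_comp {α : Type*} [MeasurableSpace α] {μ : Measure α}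
    [IsFiniteMeasure μ] {d : α → ℝ} (hd : Measurable d) {R : ℝ}
    (hR : ∀ᵐ x ∂μ, d x ∈ Icc (-R) R) (P : ℝ[X]) : Integrable (fun x => P.eval (d x)) μ := by
  obtain ⟨C, hC⟩ := isCompact_Icc.exists_bound_of_continuousOn
    (s := Icc (-R) R) P.continuous.continuousOn
  refine Integrable.of_bound (C := C) (P.continuous.measurable.comp hd).aestronglyMeasurable ?_
  filter_upwards [hR] with x hx using hC _ hx

/-- Push `|k| μ` forward by `d`. For the resulting measure `g` is close in `L¹` to a continuous
function, which Weierstrass approximates uniformly on `[-R, R]` by a polynomial, where the integral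
vanishes. -/
theorem integral_mul_comp_eq_zero_of_polynomial {𝕜 α : Type*} [RCLike 𝕜] [MeasurableSpace α]
    {μ : Measure α} {k : α → 𝕜} (hk : Integrable k μ) {d : α → ℝ}
    (hd : Measurable d) {R : ℝ} (hR : ∀ᵐ x ∂μ, d x ∈ Icc (-R) R)
    (h : ∀ P : ℝ[X], ∫ x, k x * ((P.eval (d x) : ℝ) : 𝕜) ∂μ = 0)
    {g : ℝ → ℝ} (hg : Measurable g) {C : ℝ} (hC : ∀ x, |g x| ≤ C) :
    ∫ x, k x * ((g (d x) : ℝ) : 𝕜) ∂μ = 0 := by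
  have hfin : IsFiniteMeasure (μ.withDensity fun x => ‖k x‖ₑ) :=
    ⟨by rw [withDensity_apply _ MeasurableSet.univ]; simpa [HasFiniteIntegral] using hk.2⟩
  set ρ : Measure ℝ := (μ.withDensity fun x => ‖k x‖ₑ).map d with hρ
  have hρint : ∀ u : ℝ → ℝ, Measurable u →
      ∫ t, u t ∂ρ = ∫ x, ‖k x‖ * u (d x) ∂μ := by
    intro u hu
    rw [hρ, integral_map hd.aemeasurable hu.aestronglyMeasurable,
      integral_withDensity_eq_integral_toReal_smul₀ hk.1.enorm (by simp)]
    simp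
  have hgint : Integrable g ρ := Integrable.of_bound (C := C) hg.aestronglyMeasurable
    (Filter.Eventually.of_forall hC)
  by_contra hne
  set I := ∫ x, k x * ((g (d x) : ℝ) : 𝕜) ∂μ
  have hI : 0 < ‖I‖ := norm_pos_iff.2 hne
  set M := ∫ x, ‖k x‖ ∂μ
  have hM : 0 ≤ M := integral_nonneg fun _ => norm_nonneg _
  obtain ⟨f, -, hfε, hfc, hfi⟩ := hgint.exists_hasCompactSupport_integral_sub_le
    (ε := ‖I‖ / 2) (by positivity)
  -- The denominator `2 * (M + 1)` also covers `M = 0`.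
  obtain ⟨ε, hε, hεM⟩ : ∃ ε : ℝ, 0 < ε ∧ ε * M < ‖I‖ / 2 := by
    refine ⟨‖I‖ / (2 * (M + 1)), by positivity, ?_⟩
    rw [div_mul_eq_mul_div, div_lt_div_iff₀ (by positivity) (by positivity)]
    nlinarith
  obtain ⟨P, hP⟩ := exists_polynomial_near_of_continuousOn (-R) R f hfc.continuousOn ε hε
  have hbd : ∀ u : ℝ → ℝ, Measurable u → (∃ B, ∀ᵐ x ∂μ, ‖u (d x)‖ ≤ B) →
      Integrable (fun x => k x * ((u (d x) : ℝ) : 𝕜)) μ := by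
    rintro u hu ⟨B, hB⟩
    refine hk.mul_bdd (c := B) (RCLike.measurable_ofReal.comp (hu.comp hd)).aestronglyMeasurable ?_
    filter_upwards [hB] with x hx
    simpa using hx
  have hcb : ∀ u : ℝ → ℝ, Continuous u → ∃ B, ∀ᵐ x ∂μ, ‖u (d x)‖ ≤ B := by
    intro u hu
    obtain ⟨B, hB⟩ := isCompact_Icc.exists_bound_of_continuousOn (s := Icc (-R) R) hu.continuousOn
    exact ⟨B, by filter_upwards [hR] with x hx using hB _ hx⟩
  have hg' := hbd g hg ⟨C, Filter.Eventually.of_forall fun x => hC _⟩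
  have hP' := hbd _ P.continuous.measurable (hcb _ P.continuous)
  have hd1 : Integrable (fun x => ‖k x‖ * ‖g (d x) - f (d x)‖) μ := by
    obtain ⟨B, hB⟩ := hcb f hfc
    refine hk.norm.mul_bdd (c := C + B)
      (((hg.comp hd).sub (hfc.measurable.comp hd)).norm).aestronglyMeasurable ?_
    filter_upwards [hB] with x hx
    rw [norm_norm]
    exact (norm_sub_le _ _).trans (add_le_add (hC _) hx)
  have hle : ‖I‖ ≤ ∫ t, ‖g t - f t‖ ∂ρ + ε * M := by
    have e1 : I = ∫ x, k x * (((g (d x) - P.eval (d x)) : ℝ) : 𝕜) ∂μ := by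
      rw [← sub_zero I, ← h P, ← integral_sub hg' hP']
      congr 1 with x
      push_cast
      ring
    rw [e1, hρint _ (by fun_prop), ← integral_const_mul, ← integral_add hd1 (hk.norm.const_mul _)]
    refine norm_integral_le_of_norm_le (hd1.add (hk.norm.const_mul _)) ?_
    filter_upwards [hR] with x hx
    rw [norm_mul, RCLike.norm_ofReal, ← Real.norm_eq_abs, mul_comm ε, ← mul_add]
    gcongr
    have h2 := (hP _ hx).le
    calc ‖g (d x) - eval (d x) P‖
        ≤ ‖g (d x) - f (d x)‖ + ‖f (d x) - eval (d x) P‖ := norm_sub_le_norm_sub_add_norm_sub _ _ _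
      _ ≤ _ := by
        gcongr
        rwa [norm_sub_rev]
  linarith

theorem ae_eq_zero_of_integral_mul_polynomial {𝕜 : Type*} [RCLike 𝕜] {μ : Measure ℝ}
    {k : ℝ → 𝕜} (hk : Integrable k μ) {R : ℝ} (hR : ∀ᵐ x ∂μ, x ∈ Icc (-R) R)
    (h : ∀ P : ℝ[X], ∫ x, k x * ((P.eval x : ℝ) : 𝕜) ∂μ = 0) : k =ᵐ[μ] 0 := by
  refine hk.ae_eq_zero_of_forall_setIntegral_eq_zero fun s hs _ => ?_
  have := integral_mul_comp_eq_zero_of_polynomial hk measurable_id hR h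
    (g := s.indicator 1) (measurable_one.indicator hs) (C := 1) (fun x => by
      by_cases hx : x ∈ s <;> simp [hx])
  rw [← integral_indicator hs, ← this]
  congr 1 with x
  by_cases hx : x ∈ s <;> simp [hx]

/-- Weierstrass on `[-R, R]`: moments determine a finite measure of bounded support. -/
theorem measure_eq_of_integral_polynomial {μ ν : Measure ℝ} [IsFiniteMeasure μ] [IsFiniteMeasure ν]
    {R : ℝ} (hμ : ∀ᵐ x ∂μ, x ∈ Icc (-R) R) (hν : ∀ᵐ x ∂ν, x ∈ Icc (-R) R)
    (h : ∀ P : ℝ[X], ∫ x, P.eval x ∂μ = ∫ x, P.eval x ∂ν) : μ = ν := by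
  refine ext_of_forall_integral_eq_of_IsFiniteMeasure fun f => ?_
  have key : ∀ ε > 0, |∫ x, f x ∂μ - ∫ x, f x ∂ν| ≤ ε * (μ.real univ + ν.real univ) := by
    intro ε hε
    obtain ⟨P, hP⟩ := exists_polynomial_near_of_continuousOn (-R) R f f.continuous.continuousOn ε hε
    have aux : ∀ (ρ : Measure ℝ) [IsFiniteMeasure ρ], (∀ᵐ x ∂ρ, x ∈ Icc (-R) R) →
        |∫ x, f x ∂ρ - ∫ x, P.eval x ∂ρ| ≤ ε * ρ.real univ := by
      intro ρ _ hρ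
      rw [← integral_sub (BoundedContinuousFunction.integrable ρ f)
        (integrable_polynomial_comp (d := fun x => x) measurable_id hρ P)]
      rw [← Real.norm_eq_abs]
      refine norm_integral_le_of_norm_le_const (μ := ρ) ?_
      filter_upwards [hρ] with x hx
      rw [norm_sub_rev]
      exact (hP x hx).le
    have h1 := aux μ hμ
    have h2 := aux ν hν
    rw [h P] at h1
    rw [abs_le] at *
    constructor <;> nlinarith
  by_contra hne
  have hpos : 0 < |∫ x, f x ∂μ - ∫ x, f x ∂ν| := abs_pos.2 (sub_ne_zero.2 hne)
  set B := μ.real univ + ν.real univ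
  have hB : 0 ≤ B := by positivity
  have := key (|∫ x, f x ∂μ - ∫ x, f x ∂ν| / (2 * (B + 1))) (by positivity)
  rw [div_mul_eq_mul_div, le_div_iff₀ (by positivity)] at this
  nlinarith

end PolynomialApproximation

/-! ### The semicircle law: null sets and Chebyshev moments -/

section Semicircle

open Polynomial

/-- The semicircle law on `[-2, 2]`, as the law of `2 cos θ` for the density `(2 / π) sin² θ`
on `[0, π]`. -/
noncomputable def semicircleLaw : Measure ℝ :=
  ((volume.restrict (Icc 0 Real.pi)).withDensity
    fun θ => ENNReal.ofReal (2 / Real.pi * Real.sin θ ^ 2)).map fun θ => 2 * Real.cos θ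

instance isFiniteMeasure_semicircleLaw : IsFiniteMeasure semicircleLaw := by
  have : IsFiniteMeasure ((volume.restrict (Icc 0 Real.pi)).withDensity
      fun θ => ENNReal.ofReal (2 / Real.pi * Real.sin θ ^ 2)) := by
    refine isFiniteMeasure_withDensity_ofReal ?_
    exact (Continuous.integrableOn_Icc (by fun_prop)).2
  unfold semicircleLaw
  infer_instance

/-- The map `θ ↦ 2 cos θ` is injective from `[0, π]` onto `[-2, 2]`. Its derivative and the density
`sin² θ` vanish only at the endpoints, so null sets pass in both directions. -/
theorem semicircleLaw_apply_eq_zero_iff {s : Set ℝ} (hs : MeasurableSet s) :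
    semicircleLaw s = 0 ↔ volume (s ∩ Icc (-2) 2) = 0 := by
  have hcos : Measurable fun θ : ℝ => 2 * Real.cos θ := by fun_prop
  rw [semicircleLaw, Measure.map_apply hcos hs,
    withDensity_apply_eq_zero' (by fun_prop), Measure.restrict_apply' measurableSet_Icc]
  set A : Set ℝ := (fun θ : ℝ => 2 * Real.cos θ) ⁻¹' s ∩ Icc 0 Real.pi with hA
  have hinj : InjOn (fun θ : ℝ => 2 * Real.cos θ) A := fun x hx y hy h =>
    Real.injOn_cos hx.2 hy.2 (by simpa using h)
  have himage : (fun θ : ℝ => 2 * Real.cos θ) '' A = s ∩ Icc (-2) 2 := by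
    ext t
    constructor
    · rintro ⟨θ, ⟨h1, h2⟩, rfl⟩
      exact ⟨h1, by
        constructor <;> dsimp only <;> linarith [Real.cos_le_one θ, Real.neg_one_le_cos θ]⟩
    · rintro ⟨h1, h2, h3⟩
      have : 2 * Real.cos (Real.arccos (t / 2)) = t := by
        rw [Real.cos_arccos (by linarith) (by linarith)]; ring
      refine ⟨Real.arccos (t / 2), ⟨?_, Real.arccos_nonneg _, Real.arccos_le_pi _⟩, this⟩
      rw [mem_preimage, this]
      exact h1
  have hAm : MeasurableSet A := (hcos hs).inter measurableSet_Icc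
  have hsin : ∀ᵐ θ : ℝ, θ ∈ Icc 0 Real.pi → 0 < Real.sin θ := by
    have : ∀ᵐ θ : ℝ, θ ∉ ({0, Real.pi} : Set ℝ) :=
      compl_mem_ae_iff.2 ((finite_singleton _).insert _ |>.measure_zero _)
    filter_upwards [this] with θ hθ h
    simp only [mem_insert_iff, mem_singleton_iff, not_or] at hθ
    exact Real.sin_pos_of_pos_of_lt_pi (lt_of_le_of_ne h.1 (Ne.symm hθ.1)) (lt_of_le_of_ne h.2 hθ.2)
  have h1 : volume ({θ | ENNReal.ofReal (2 / Real.pi * Real.sin θ ^ 2) ≠ 0} ∩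
      (fun θ : ℝ => 2 * Real.cos θ) ⁻¹' s ∩ Icc 0 Real.pi) = volume A := by
    refine measure_congr ?_
    filter_upwards [hsin] with θ hθ
    refine propext ⟨fun h => ⟨h.1.2, h.2⟩, fun h => ⟨⟨?_, h.1⟩, h.2⟩⟩
    have := hθ h.2
    have := Real.pi_pos
    show ENNReal.ofReal (2 / Real.pi * Real.sin θ ^ 2) ≠ 0
    rw [Ne, ENNReal.ofReal_eq_zero, not_le]
    positivity
  rw [h1, ← himage]
  constructor
  · exact fun h => addHaar_image_eq_zero_of_differentiableOn_of_addHaar_eq_zero volume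
      (by fun_prop) h
  · intro h
    have h2 := lintegral_image_eq_lintegral_abs_deriv_mul (f' := fun θ => 2 * -Real.sin θ) hAm
      (fun x _ => ((Real.hasDerivAt_cos x).const_mul 2).hasDerivWithinAt) hinj (fun _ => 1)
    rw [setLIntegral_const, h, mul_zero, eq_comm, lintegral_eq_zero_iff (by fun_prop)] at h2
    have h3 : ∀ᵐ θ ∂(volume.restrict A), False := by
      filter_upwards [h2, ae_restrict_of_ae hsin, ae_restrict_mem hAm] with θ h4 h5 h6
      have := h5 h6.2
      simp [this.ne'] at h4
    rw [ae_iff] at h3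
    simpa using h3

theorem semicircleLaw_ae_mem : ∀ᵐ t ∂semicircleLaw, t ∈ Icc (-2 : ℝ) 2 := by
  refine (semicircleLaw_apply_eq_zero_iff measurableSet_Icc.compl).2 ?_
  simp

/-- At `t = 2 cos θ` one has `S k (t) sin θ = sin ((k+1)θ)`, so the integrand is `(cos kθ - cos
(k+2)θ) / π`. Since the `S k` span all polynomials, these values characterise the law. -/
theorem integral_chebyshevS_semicircleLaw (k : ℕ) :
    ∫ t, (Chebyshev.S ℝ k).eval t ∂semicircleLaw = if k = 0 then 1 else 0 := by
  rw [semicircleLaw, integral_map (by fun_prop)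
    (Polynomial.continuous _).measurable.aestronglyMeasurable,
    integral_withDensity_eq_integral_toReal_smul (by fun_prop) (by simp)]
  have h1 : ∀ θ : ℝ, (ENNReal.ofReal (2 / Real.pi * Real.sin θ ^ 2)).toReal •
      (Chebyshev.S ℝ k).eval (2 * Real.cos θ)
      = (Real.pi)⁻¹ * (Real.cos (k * θ) - Real.cos ((k + 2 : ℕ) * θ)) := by
    intro θ
    rw [ENNReal.toReal_ofReal (by have := Real.pi_pos; positivity), smul_eq_mul]
    have h2 := Chebyshev.S_two_mul_real_cos θ k
    have h3 : Real.cos (k * θ) - Real.cos ((k + 2 : ℕ) * θ)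
        = 2 * Real.sin (((k : ℤ) + 1 : ℝ) * θ) * Real.sin θ := by
      rw [Real.cos_sub_cos]
      push_cast
      rw [show (k * θ - (k + 2) * θ) / 2 = -θ by ring,
        show (k * θ + (k + 2) * θ) / 2 = ((k : ℝ) + 1) * θ by ring, Real.sin_neg]
      ring
    rw [h3, ← h2]
    field_simp
  simp_rw [h1]
  have h4 : ∀ n : ℕ, ∫ θ in (0 : ℝ)..Real.pi, Real.cos (n * θ) = if n = 0 then Real.pi else 0 := by
    intro n
    split_ifs with hn
    · simp [hn]
    · rw [intervalIntegral.integral_comp_mul_left (fun θ => Real.cos θ) (by exact_mod_cast hn)]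
      simp [Real.sin_nat_mul_pi]
  rw [integral_Icc_eq_integral_Ioc, ← intervalIntegral.integral_of_le Real.pi_pos.le,
    intervalIntegral.integral_const_mul, intervalIntegral.integral_sub
      (Continuous.intervalIntegrable (by fun_prop) _ _)
      (Continuous.intervalIntegrable (by fun_prop) _ _), h4, h4]
  have := Real.pi_pos
  split_ifs <;> simp_all

theorem span_chebyshevS : Submodule.span ℝ (range fun k : ℕ => Chebyshev.S ℝ (k : ℤ)) = ⊤ := by
  refine Polynomial.submodule_eq_top_of_X_mul_mem
    (Submodule.subset_span ⟨0, by simp⟩) fun P hP => ?_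
  induction hP using Submodule.span_induction with
  | zero => simp
  | add P Q _ _ hP hQ => rw [mul_add]; exact Submodule.add_mem _ hP hQ
  | smul c P _ hP => rw [mul_smul_comm]; exact Submodule.smul_mem _ _ hP
  | mem P hP =>
    obtain ⟨k, rfl⟩ := hP
    have h : (X : ℝ[X]) * Chebyshev.S ℝ (k : ℤ)
        = Chebyshev.S ℝ ((k + 1 : ℕ) : ℤ) + Chebyshev.S ℝ ((k : ℤ) - 1) := by
      push_cast
      rw [Chebyshev.S_add_one]
      ring
    dsimp only
    rw [h]
    refine Submodule.add_mem _ (Submodule.subset_span ⟨k + 1, rfl⟩) ?_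
    -- For `k = 0` the lower neighbour is `S (-1) = 0`.
    rcases k with _ | k
    · simp
    · exact Submodule.subset_span ⟨k, by push_cast; ring_nf⟩

end Semicircle

/-! ### Null sets of the spectral measure of a periodic Jacobi matrix -/

section PeriodicSpectralMeasure

open Polynomial

/-- Orthogonality relations satisfied by the spectral measure `μ` of a periodic Jacobi matrix on
the half line: `a` is the orthogonal polynomial of degree one less than the period, `d` is the
discriminant, and the divided difference of `d` is `a(x) + ∑ j, c j (y) * q j (x)`. -/
structure IsPeriodicSpectralMeasure {r : ℕ} (μ : Measure ℝ) (a d : ℝ[X]) (q c : Fin r → ℝ[X]) :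
    Prop where
  bounded : ∃ R, ∀ᵐ x ∂μ, x ∈ Icc (-R) R
  integral_sq : ∀ k : ℕ, ∫ x, a.eval x ^ 2 * (Chebyshev.S ℝ k).eval (d.eval x) ∂μ
    = if k = 0 then 1 else 0
  integral_mul : ∀ j, ∀ k : ℕ, ∫ x, (q j).eval x * a.eval x *
    (Chebyshev.S ℝ k).eval (d.eval x) ∂μ = 0
  divided_difference : ∀ x y : ℝ,
    (x - y) * (a.eval x + ∑ j, (c j).eval y * (q j).eval x) = d.eval x - d.eval y

namespace IsPeriodicSpectralMeasure

variable {r : ℕ} {μ : Measure ℝ} {a d : ℝ[X]} {q c : Fin r → ℝ[X]}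

theorem bounded_discriminant (h : IsPeriodicSpectralMeasure μ a d q c) :
    ∃ R, 2 ≤ R ∧ ∀ᵐ x ∂μ, d.eval x ∈ Icc (-R) R := by
  obtain ⟨R, hR⟩ := h.bounded
  obtain ⟨C, hC⟩ := isCompact_Icc.exists_bound_of_continuousOn
    (s := Icc (-R) R) d.continuous.continuousOn
  refine ⟨max 2 C, le_max_left _ _, ?_⟩
  filter_upwards [hR] with x hx
  exact abs_le.1 ((hC x hx).trans (le_max_right _ _))

variable [IsFiniteMeasure μ]

theorem integrable_eval (h : IsPeriodicSpectralMeasure μ a d q c) (P : ℝ[X]) :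
    Integrable (fun x => P.eval x) μ := by
  obtain ⟨R, hR⟩ := h.bounded
  exact integrable_polynomial_comp (d := fun x => x) measurable_id hR P

/-- Bounded measurable functions of the discriminant are needed, not only polynomials, because the
inverse branch of `d` used below is merely measurable. -/
theorem integral_mul_comp (h : IsPeriodicSpectralMeasure μ a d q c) (j : Fin r) {g : ℝ → ℝ}
    (hg : Measurable g) {C : ℝ} (hC : ∀ x, |g x| ≤ C) :
    ∫ x, (q j).eval x * a.eval x * g (d.eval x) ∂μ = 0 := by
  obtain ⟨R, -, hR⟩ := h.bounded_discriminant
  refine integral_mul_comp_eq_zero_of_polynomial (𝕜 := ℝ)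
    (by simpa using h.integrable_eval (q j * a)) d.continuous.measurable hR (fun P => ?_) hg hC
  simp only [RCLike.ofReal_real_eq_id, id]
  have hP : P ∈ Submodule.span ℝ (range fun k : ℕ => Chebyshev.S ℝ (k : ℤ)) := by
    rw [span_chebyshevS]; trivial
  induction hP using Submodule.span_induction with
  | zero => simp
  | add P Q _ _ hP hQ =>
    simp_rw [eval_add, mul_add]
    rw [integral_add, hP, hQ, add_zero]
    · simpa using h.integrable_eval (q j * a * P.comp d)
    · simpa using h.integrable_eval (q j * a * Q.comp d)
  | smul b P _ hP =>
    simp_rw [eval_smul, smul_eq_mul, mul_left_comm _ b]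
    rw [integral_const_mul, hP, mul_zero]
  | mem P hP =>
    obtain ⟨k, rfl⟩ := hP
    exact h.integral_mul j k

/-- Both measures have bounded support and the same integrals against every `S k`, and the `S k`
span the polynomials. -/
theorem map_withDensity (h : IsPeriodicSpectralMeasure μ a d q c) :
    (μ.withDensity fun x => ENNReal.ofReal (a.eval x ^ 2)).map (fun x => d.eval x)
      = semicircleLaw := by
  obtain ⟨R, hR2, hR⟩ := h.bounded_discriminant
  have hfin : IsFiniteMeasure (μ.withDensity fun x => ENNReal.ofReal (a.eval x ^ 2)) :=
    isFiniteMeasure_withDensity_ofReal (by simpa [sq] using (h.integrable_eval (a * a)).2)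
  have hint : ∀ P : ℝ[X], ∫ t, P.eval t ∂((μ.withDensity fun x =>
      ENNReal.ofReal (a.eval x ^ 2)).map (fun x => d.eval x))
      = ∫ x, a.eval x ^ 2 * P.eval (d.eval x) ∂μ := by
    intro P
    rw [integral_map d.continuous.measurable.aemeasurable P.continuous.aestronglyMeasurable,
      integral_withDensity_eq_integral_toReal_smul (by fun_prop) (by simp)]
    congr 1 with x
    rw [ENNReal.toReal_ofReal (by positivity), smul_eq_mul]
  refine measure_eq_of_integral_polynomial (R := R) ?_ ?_ fun P => ?_
  · refine (ae_map_iff d.continuous.measurable.aemeasurable measurableSet_Icc).2 ?_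
    exact (withDensity_absolutelyContinuous _ _).ae_le hR
  · filter_upwards [semicircleLaw_ae_mem] with t ht
    exact ⟨by linarith [ht.1], by linarith [ht.2]⟩
  · have hP : P ∈ Submodule.span ℝ (range fun k : ℕ => Chebyshev.S ℝ (k : ℤ)) := by
      rw [span_chebyshevS]; trivial
    have hi1 : ∀ P : ℝ[X], Integrable (fun x => a.eval x ^ 2 * P.eval (d.eval x)) μ :=
      fun P => by simpa [sq] using h.integrable_eval (a * a * P.comp d)
    have hi2 : ∀ P : ℝ[X], Integrable (fun t => P.eval t) semicircleLaw :=
      fun P => integrable_polynomial_comp (d := fun x => x) measurable_id semicircleLaw_ae_mem P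
    rw [hint]
    induction hP using Submodule.span_induction with
    | zero => simp
    | add P Q _ _ hP hQ =>
      simp_rw [eval_add, mul_add]
      rw [integral_add (hi1 P) (hi1 Q), integral_add (hi2 P) (hi2 Q), hP, hQ]
    | smul b P _ hP =>
      simp_rw [eval_smul, smul_eq_mul, mul_left_comm _ b]
      rw [integral_const_mul, integral_const_mul, hP]
    | mem P hP =>
      obtain ⟨k, rfl⟩ := hP
      rw [h.integral_sq, integral_chebyshevS_semicircleLaw]

theorem semicircleLaw_apply (h : IsPeriodicSpectralMeasure μ a d q c) {s : Set ℝ}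
    (hs : MeasurableSet s) :
    semicircleLaw s = ∫⁻ x in (fun x => d.eval x) ⁻¹' s, ENNReal.ofReal (a.eval x ^ 2) ∂μ := by
  rw [← h.map_withDensity, Measure.map_apply d.continuous.measurable hs,
    withDensity_apply _ (d.continuous.measurable hs)]

/-- Since `a² > 0` on the set in question, a null set of the semicircle law pulls back to a `μ`-null
set. The set `s` need not be measurable, hence the measurable hull `t`, enlarged by the complement
of `[-2, 2]`. -/
theorem measure_preimage_eq_zero (h : IsPeriodicSpectralMeasure μ a d q c) {s : Set ℝ}
    (hs : volume (s ∩ Icc (-2) 2) = 0) :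
    μ ((fun x => d.eval x) ⁻¹' s ∩ {x | a.eval x ≠ 0}) = 0 := by
  obtain ⟨t, hst, ht, hvt⟩ := exists_measurable_superset_of_null hs
  have hmeas : MeasurableSet (t ∪ (Icc (-2) 2)ᶜ) := ht.union measurableSet_Icc.compl
  have hsub : s ⊆ t ∪ (Icc (-2) 2)ᶜ := fun x hx => by
    by_cases hx2 : x ∈ Icc (-2 : ℝ) 2
    · exact Or.inl (hst ⟨hx, hx2⟩)
    · exact Or.inr hx2
  have h0 : semicircleLaw (t ∪ (Icc (-2) 2)ᶜ) = 0 := by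
    rw [semicircleLaw_apply_eq_zero_iff hmeas]
    refine measure_mono_null ?_ hvt
    rintro x ⟨hx | hx, hx2⟩
    exacts [hx, absurd hx2 hx]
  rw [h.semicircleLaw_apply hmeas, lintegral_eq_zero_iff (by fun_prop)] at h0
  refine measure_mono_null (inter_subset_inter_left _ (preimage_mono hsub)) ?_
  have h1 := (ae_restrict_iff' (d.continuous.measurable hmeas)).1 h0
  refine measure_mono_null ?_ (ae_iff.1 h1)
  rintro x ⟨hx, hax⟩ hx2
  have hx3 := hx2 hx
  have : 0 < a.eval x ^ 2 := by have : a.eval x ≠ 0 := hax; positivity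
  simp [this.not_ge] at hx3

theorem ae_discriminant_mem (h : IsPeriodicSpectralMeasure μ a d q c) :
    ∀ᵐ x ∂μ, a.eval x = 0 ∨ d.eval x ∈ Icc (-2 : ℝ) 2 := by
  refine measure_mono_null ?_ (h.measure_preimage_eq_zero (s := (Icc (-2) 2)ᶜ) (by simp))
  intro x hx
  have hx' : ¬ (a.eval x = 0 ∨ d.eval x ∈ Icc (-2 : ℝ) 2) := hx
  rw [not_or] at hx'
  exact ⟨hx'.2, hx'.1⟩

/-- A polynomial maps Lebesgue null sets to Lebesgue null sets, so this follows by applying the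
previous result to the image of `s`. -/
theorem measure_eq_zero_of_volume (h : IsPeriodicSpectralMeasure μ a d q c) {s : Set ℝ}
    (hs : volume s = 0) (ha : ∀ x ∈ s, a.eval x ≠ 0) : μ s = 0 := by
  have := addHaar_image_eq_zero_of_differentiableOn_of_addHaar_eq_zero volume
    d.differentiable.differentiableOn hs
  refine measure_mono_null ?_ (h.measure_preimage_eq_zero (s := (fun x => d.eval x) '' s)
    (measure_mono_null inter_subset_left this))
  exact fun x hx => ⟨mem_image_of_mem _ hx, ha x hx⟩

/-- Let `y` invert `d` on `T = d(s)`. Integrate `a(x)` times the divided difference of `d` at `x`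
and `y(d x)` over `d⁻¹(T)`. The integrand vanishes for `x ∉ s`, since then `x ≠ y(d x)` have equal
discriminants, and `s` is `μ`-null. The terms containing `q j` integrate to zero by orthogonality.
What remains is `∫ a²` over `d⁻¹(T)`, the semicircle mass of `T`; so `T`, and with it `s`, is
Lebesgue null. -/
theorem volume_eq_zero_of_measure (h : IsPeriodicSpectralMeasure μ a d q c)
    (hd : d.derivative ≠ 0) {s : Set ℝ} (hs : MeasurableSet s) (hμs : μ s = 0) {B : ℝ}
    (hB : s ⊆ Icc (-B) B) (hinj : InjOn (fun x => d.eval x) s)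
    (hds : ∀ x ∈ s, d.eval x ∈ Icc (-2 : ℝ) 2) : volume s = 0 := by
  have hemb := d.continuous.continuousOn.measurableEmbedding hs hinj
  obtain ⟨y, hy, hyd⟩ := hemb.exists_measurable_extend measurable_subtype_coe (fun _ => ⟨0⟩)
  have hyd' : ∀ x ∈ s, y (d.eval x) = x := fun x hx => congr_fun hyd ⟨x, hx⟩
  set T : Set ℝ := (fun x => d.eval x) '' s
  have hT : MeasurableSet T := hs.image_of_continuousOn_injOn d.continuous.continuousOn hinj
  have hyT : ∀ t ∈ T, y t ∈ s ∧ d.eval (y t) = t := by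
    rintro _ ⟨x, hx, rfl⟩
    simp only [hyd' x hx]
    exact ⟨hx, trivial⟩
  have hsum : ∀ j, ∫ x, (q j).eval x * a.eval x *
      T.indicator (fun t => (c j).eval (y t)) (d.eval x) ∂μ = 0 := by
    intro j
    obtain ⟨C, hC⟩ := isCompact_Icc.exists_bound_of_continuousOn
      (s := Icc (-B) B) (c j).continuous.continuousOn
    refine h.integral_mul_comp j (((c j).continuous.measurable.comp hy).indicator hT)
      (C := max C 0) fun t => ?_
    by_cases ht : t ∈ T
    · rw [indicator_of_mem ht]
      exact (hC _ (hB (hyT t ht).1)).trans (le_max_left _ _)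
    · rw [indicator_of_notMem ht, abs_zero]
      exact le_max_right _ _
  have hci : ∀ j, Integrable (fun x => (q j).eval x * a.eval x *
      T.indicator (fun t => (c j).eval (y t)) (d.eval x)) μ := by
    intro j
    obtain ⟨C, hC⟩ := isCompact_Icc.exists_bound_of_continuousOn
      (s := Icc (-B) B) (c j).continuous.continuousOn
    have hq : Integrable (fun x => (q j).eval x * a.eval x) μ := by
      simpa using h.integrable_eval (q j * a)
    refine hq.mul_bdd (c := max C 0) ((((c j).continuous.measurable.comp hy).indicator hT).comp
      d.continuous.measurable).aestronglyMeasurable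
      (Filter.Eventually.of_forall fun x => ?_)
    by_cases ht : d.eval x ∈ T
    · rw [indicator_of_mem ht]
      exact (hC _ (hB (hyT _ ht).1)).trans (le_max_left _ _)
    · rw [indicator_of_notMem ht, norm_zero]
      exact le_max_right _ _
  have hsq : Integrable (fun x => a.eval x ^ 2 * T.indicator 1 (d.eval x)) μ := by
    have hq : Integrable (fun x => a.eval x ^ 2) μ := by
      simpa [sq] using h.integrable_eval (a * a)
    refine hq.mul_bdd (c := 1) ((measurable_one.indicator hT).comp
      d.continuous.measurable).aestronglyMeasurable (Filter.Eventually.of_forall fun x => ?_)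
    by_cases ht : d.eval x ∈ T <;> simp [ht]
  have hzero : ∫ x, (a.eval x ^ 2 * T.indicator 1 (d.eval x) + ∑ j, (q j).eval x * a.eval x *
      T.indicator (fun t => (c j).eval (y t)) (d.eval x)) ∂μ = 0 := by
    refine integral_eq_zero_of_ae ?_
    have hns : ∀ᵐ x ∂μ, x ∉ s := by rw [ae_iff]; simpa using hμs
    filter_upwards [hns] with x hx
    by_cases ht : d.eval x ∈ T
    · have h1 := h.divided_difference x (y (d.eval x))
      rw [(hyT _ ht).2, sub_self, mul_eq_zero, sub_eq_zero] at h1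
      have h2 : x ≠ y (d.eval x) := fun h2 => hx (h2 ▸ (hyT _ ht).1)
      have h3 := h1.resolve_left h2
      simp only [indicator_of_mem ht, Pi.one_apply, Pi.zero_apply]
      calc _ = a.eval x * (a.eval x + ∑ j, (c j).eval (y (d.eval x)) * (q j).eval x) := by
            rw [mul_add, Finset.mul_sum]
            congr 1
            · ring
            · exact Finset.sum_congr rfl fun j _ => by ring
        _ = 0 := by rw [h3, mul_zero]
    · simp [indicator_of_notMem ht]
  rw [integral_add hsq (integrable_finsetSum _ fun j _ => hci j),
    integral_finsetSum _ fun j _ => hci j, Finset.sum_congr rfl fun j _ => hsum j,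
    Finset.sum_const_zero, add_zero,
    integral_eq_zero_iff_of_nonneg (fun x => mul_nonneg (sq_nonneg (a.eval x))
      (indicator_nonneg (f := (1 : ℝ → ℝ)) (fun _ _ => zero_le_one) (d.eval x))) hsq] at hzero
  have hscT : semicircleLaw T = 0 := by
    rw [h.semicircleLaw_apply hT, lintegral_eq_zero_iff (by fun_prop)]
    filter_upwards [ae_restrict_of_ae hzero, ae_restrict_mem (d.continuous.measurable hT)]
      with x hx hxT
    have hxT' : d.eval x ∈ T := hxT
    simpa [indicator_of_mem hxT'] using hx
  rw [semicircleLaw_apply_eq_zero_iff hT, inter_eq_left.2] at hscT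
  -- Return from `T` to `s` by the change of variables formula; `d'` has only finitely many zeros.
  · have h2 := lintegral_image_eq_lintegral_abs_deriv_mul (f' := fun x => d.derivative.eval x) hs
      (fun x _ => (d.hasDerivAt x).hasDerivWithinAt) hinj (fun _ => 1)
    rw [setLIntegral_const, hscT, mul_zero, eq_comm,
      lintegral_eq_zero_iff (by fun_prop)] at h2
    have h4 : ∀ᵐ x : ℝ, d.derivative.eval x ≠ 0 := by
      have : {x | d.derivative.IsRoot x}.Finite := Polynomial.finite_setOfPred_isRoot hd
      exact measure_mono_null (fun x hx => by simpa using hx) (this.measure_zero volume)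
    have h3 : ∀ᵐ θ ∂(volume.restrict s), False := by
      filter_upwards [h2, ae_restrict_of_ae h4] with θ h5 h6
      simp [h6] at h5
    rw [ae_iff] at h3
    simpa using h3
  · rintro _ ⟨x, hx, rfl⟩
    exact hds x hx

end IsPeriodicSpectralMeasure

end PeriodicSpectralMeasure

/-! ### Spectral measures from the Riesz–Markov theorem -/

section SpectralMeasure

open Polynomial
open scoped InnerProductSpace

variable {H : Type*} [NormedAddCommGroup H] [InnerProductSpace ℂ H] [CompleteSpace H]

theorem ContinuousLinearMap.inner_self_mul_apply_of_isSelfAdjoint {S : H →L[ℂ] H}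
    (hS : IsSelfAdjoint S) (e : H) : ⟪e, (S * S) e⟫_ℂ = (‖S e‖ : ℂ) ^ 2 := by
  rw [mul_apply_eq_comp, ← ContinuousLinearMap.adjoint_inner_left,
    ← ContinuousLinearMap.star_eq_adjoint, hS.star_eq, inner_self_eq_norm_sq_to_K]
  rfl

/-- The spectral measure of a selfadjoint operator at a vector. -/
theorem exists_spectralMeasure {T : H →L[ℂ] H} (hT : IsSelfAdjoint T) (e : H) :
    ∃ μ : Measure ℝ, IsFiniteMeasure μ ∧ μ (spectrum ℝ T)ᶜ = 0 ∧
      ∀ f : ℝ → ℝ, Continuous f → ∫ x, f x ∂μ = (⟪e, cfc f T e⟫_ℂ).re := by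
  have hcomp : CompactSpace (spectrum ℝ T) := isCompact_iff_compactSpace.1 (spectrum.isCompact T)
  let Λ₀ : CompactlySupportedContinuousMap (spectrum ℝ T) ℝ →ₗ[ℝ] ℝ :=
    { toFun := fun f => (⟪e, cfcHom hT (f : C(spectrum ℝ T, ℝ)) e⟫_ℂ).re
      map_add' := fun f g => by
        have : ((f + g : CompactlySupportedContinuousMap (spectrum ℝ T) ℝ) : C(spectrum ℝ T, ℝ))
          = (f : C(spectrum ℝ T, ℝ)) + (g : C(spectrum ℝ T, ℝ)) := rfl
        rw [this, map_add, add_apply, inner_add_right, Complex.add_re]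
      map_smul' := fun c f => by
        have : ((c • f : CompactlySupportedContinuousMap (spectrum ℝ T) ℝ) : C(spectrum ℝ T, ℝ))
          = c • (f : C(spectrum ℝ T, ℝ)) := rfl
        rw [this, map_smul, smul_apply, ← Complex.coe_smul, inner_smul_right]
        simp }
  let Λ : CompactlySupportedContinuousMap (spectrum ℝ T) ℝ →ₚ[ℝ] ℝ :=
    -- Positivity: `f = (√f)²`, so the functional at `f` is `‖√f(T) e‖²`.
    PositiveLinearMap.mk₀ Λ₀ (fun f hf => by
      let g : C(spectrum ℝ T, ℝ) := ⟨fun x => √(f x), by fun_prop⟩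
      have hfg : (f : C(spectrum ℝ T, ℝ)) = g * g := by
        ext x
        exact (Real.mul_self_sqrt (hf x)).symm
      have hg : IsSelfAdjoint (cfcHom hT g) := by
        rw [IsSelfAdjoint, ← map_star]
        congr 1
      show 0 ≤ (⟪e, cfcHom hT (f : C(spectrum ℝ T, ℝ)) e⟫_ℂ).re
      rw [hfg, map_mul, ContinuousLinearMap.inner_self_mul_apply_of_isSelfAdjoint hg]
      norm_cast
      positivity)
  have hfin : IsFiniteMeasure (RealRMK.rieszMeasure Λ) := by infer_instance
  refine ⟨(RealRMK.rieszMeasure Λ).map Subtype.val, inferInstance, ?_, fun f hf => ?_⟩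
  · rw [Measure.map_apply measurable_subtype_coe (spectrum.isClosed T).measurableSet.compl]
    simp
  · rw [integral_map measurable_subtype_coe.aemeasurable hf.aestronglyMeasurable]
    let F : CompactlySupportedContinuousMap (spectrum ℝ T) ℝ :=
      ⟨⟨fun x => f x, by fun_prop⟩, HasCompactSupport.of_compactSpace _⟩
    have := RealRMK.integral_rieszMeasure Λ F
    refine this.trans ?_
    rw [cfc_apply f T hT hf.continuousOn]
    rfl

end SpectralMeasure

/-! ### Orthogonal polynomials and the spectrum of a Jacobi chain -/

section JacobiChain

open Polynomial
open scoped InnerProductSpace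

/-- The orthogonal polynomials of the half-line Jacobi matrix with off-diagonal entries `1` and
diagonal entries `V`. -/
noncomputable def jacobiPolynomial (V : ℕ → ℝ) : ℕ → ℝ[X]
  | 0 => 1
  | 1 => X - C (V 0)
  | n + 2 => (X - C (V (n + 1))) * jacobiPolynomial V (n + 1) - jacobiPolynomial V n

theorem jacobiPolynomial_zero (V : ℕ → ℝ) : jacobiPolynomial V 0 = 1 := by
  rw [jacobiPolynomial]

theorem jacobiPolynomial_one (V : ℕ → ℝ) : jacobiPolynomial V 1 = X - C (V 0) := by
  rw [jacobiPolynomial]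

theorem jacobiPolynomial_add_two (V : ℕ → ℝ) (n : ℕ) : jacobiPolynomial V (n + 2) =
    (X - C (V (n + 1))) * jacobiPolynomial V (n + 1) - jacobiPolynomial V n := by
  rw [jacobiPolynomial]

theorem X_mul_jacobiPolynomial_zero (V : ℕ → ℝ) :
    X * jacobiPolynomial V 0 = jacobiPolynomial V 1 + C (V 0) * jacobiPolynomial V 0 := by
  rw [jacobiPolynomial_zero, jacobiPolynomial_one]
  ring

theorem X_mul_jacobiPolynomial_succ (V : ℕ → ℝ) (n : ℕ) :
    X * jacobiPolynomial V (n + 1) = jacobiPolynomial V (n + 2) +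
      C (V (n + 1)) * jacobiPolynomial V (n + 1) + jacobiPolynomial V n := by
  rw [jacobiPolynomial_add_two]
  ring

theorem span_jacobiPolynomial (V : ℕ → ℝ) :
    Submodule.span ℝ (range (jacobiPolynomial V)) = ⊤ := by
  refine Polynomial.submodule_eq_top_of_X_mul_mem
    (Submodule.subset_span ⟨0, jacobiPolynomial_zero V⟩) fun P hP => ?_
  have hmem : ∀ n, jacobiPolynomial V n ∈ Submodule.span ℝ (range (jacobiPolynomial V)) :=
    fun n => Submodule.subset_span ⟨n, rfl⟩
  induction hP using Submodule.span_induction with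
  | zero => simp
  | add P Q _ _ hP hQ => rw [mul_add]; exact Submodule.add_mem _ hP hQ
  | smul c P _ hP => rw [mul_smul_comm]; exact Submodule.smul_mem _ _ hP
  | mem P hP =>
    obtain ⟨n, rfl⟩ := hP
    rcases n with _ | n
    · rw [X_mul_jacobiPolynomial_zero, ← smul_eq_C_mul]
      exact Submodule.add_mem _ (hmem _) (Submodule.smul_mem _ _ (hmem _))
    · rw [X_mul_jacobiPolynomial_succ, ← smul_eq_C_mul]
      exact Submodule.add_mem _ (Submodule.add_mem _ (hmem _) (Submodule.smul_mem _ _ (hmem _)))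
        (hmem _)

variable {H : Type*} [NormedAddCommGroup H] [InnerProductSpace ℂ H]

/-- An orthonormal sequence on which `T` acts as the half-line Jacobi matrix with diagonal `V`. -/
structure IsJacobiChain (T : H →L[ℂ] H) (V : ℕ → ℝ) (e : ℕ → H) : Prop where
  orthonormal : Orthonormal ℂ e
  apply_zero : T (e 0) = e 1 + (V 0 : ℂ) • e 0
  apply_succ : ∀ n, T (e (n + 1)) = e (n + 2) + (V (n + 1) : ℂ) • e (n + 1) + e n

/-- Both sides satisfy the same three-term recursion. This is what turns orthonormality of the chain
into orthonormality of the polynomials in `L²(μ)`. -/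
theorem IsJacobiChain.aeval_apply {T : H →L[ℂ] H} {V : ℕ → ℝ} {e : ℕ → H}
    (h : IsJacobiChain T V e) (n : ℕ) : aeval T (jacobiPolynomial V n) (e 0) = e n := by
  have hX : ∀ (c : ℝ) (P : ℝ[X]), aeval T ((X - C c) * P) (e 0)
      = T (aeval T P (e 0)) - (c : ℂ) • aeval T P (e 0) := by
    intro c P
    rw [map_mul, mul_apply_eq_comp, map_sub, aeval_X, aeval_C, sub_apply,
      Algebra.algebraMap_eq_smul_one, smul_apply, Complex.coe_smul]
    rfl
  induction n using Nat.twoStepInduction with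
  | zero => simp [jacobiPolynomial_zero]
  | one =>
    rw [jacobiPolynomial_one, ← mul_one (X - C (V 0)), hX]
    simp [h.apply_zero]
  | more n ih1 ih2 =>
    rw [jacobiPolynomial_add_two, map_sub, sub_apply, hX, ih1, ih2, h.apply_succ]
    abel

variable [CompleteSpace H]

/-- `μ` is the spectral measure of `T` at `e`. -/
structure IsSpectralMeasure (μ : Measure ℝ) (T : H →L[ℂ] H) (e : H) : Prop where
  isFiniteMeasure : IsFiniteMeasure μ
  null : μ (spectrum ℝ T)ᶜ = 0
  integral_eq : ∀ f : ℝ → ℝ, Continuous f → ∫ x, f x ∂μ = (⟪e, cfc f T e⟫_ℂ).re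

namespace IsJacobiChain

variable {T : H →L[ℂ] H} {V : ℕ → ℝ} {e : ℕ → H} {μ : Measure ℝ}

theorem integral_mul (hT : IsSelfAdjoint T) (h : IsJacobiChain T V e)
    (hμ : IsSpectralMeasure μ T (e 0)) (m n : ℕ) :
    ∫ x, (jacobiPolynomial V m).eval x * (jacobiPolynomial V n).eval x ∂μ
      = if m = n then 1 else 0 := by
  have hsa : IsSelfAdjoint (aeval T (jacobiPolynomial V m)) := by
    rw [← cfc_polynomial _ T hT]
    exact cfc_predicate _ _
  have h1 := hμ.integral_eq _ (jacobiPolynomial V m * jacobiPolynomial V n).continuous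
  simp only [eval_mul] at h1
  rw [h1]
  simp only [← eval_mul]
  rw [cfc_polynomial _ T hT, map_mul, mul_apply_eq_comp, ← ContinuousLinearMap.adjoint_inner_left,
    ← ContinuousLinearMap.star_eq_adjoint, hsa.star_eq, h.aeval_apply, h.aeval_apply,
    orthonormal_iff_ite.1 h.orthonormal]
  split_ifs <;> simp

theorem norm_cfc_apply_sq (hT : IsSelfAdjoint T) (h : IsJacobiChain T V e)
    (hμ : IsSpectralMeasure μ T (e 0)) {f : ℝ → ℝ} (hf : Continuous f) (n : ℕ) :
    ‖cfc f T (e n)‖ ^ 2 = ∫ x, (f x * (jacobiPolynomial V n).eval x) ^ 2 ∂μ := by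
  have hp := (jacobiPolynomial V n).continuous
  have hsa : IsSelfAdjoint (cfc (fun x => f x * (jacobiPolynomial V n).eval x) T) :=
    cfc_predicate _ _
  have h1 : cfc f T (e n) = cfc (fun x => f x * (jacobiPolynomial V n).eval x) T (e 0) := by
    rw [cfc_mul f _ T hf.continuousOn hp.continuousOn, cfc_polynomial _ T hT, mul_apply_eq_comp,
      h.aeval_apply]
  rw [hμ.integral_eq _ (by fun_prop)]
  simp_rw [sq]
  rw [cfc_mul _ _ T (by fun_prop) (by fun_prop),
    ContinuousLinearMap.inner_self_mul_apply_of_isSelfAdjoint hsa, ← h1]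
  norm_cast
  rw [sq]

theorem cfc_apply_eq_zero (hT : IsSelfAdjoint T) (h : IsJacobiChain T V e)
    (hμ : IsSpectralMeasure μ T (e 0)) {f : ℝ → ℝ} (hf : Continuous f)
    (hfμ : ∀ᵐ x ∂μ, f x = 0) (n : ℕ) : cfc f T (e n) = 0 := by
  rw [← norm_eq_zero, ← sq_eq_zero_iff, h.norm_cfc_apply_sq hT hμ hf]
  refine integral_eq_zero_of_ae ?_
  filter_upwards [hfμ] with x hx
  simp [hx]

/-- By `hper`, multiplying `p r` by `S k (d)` gives the polynomial of index `(r+1)k + r`. Both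
integral relations are thus orthonormality, against `p r` or against `p j` with `j < r`. -/
theorem isPeriodicSpectralMeasure (hT : IsSelfAdjoint T) (h : IsJacobiChain T V e)
    (hμ : IsSpectralMeasure μ T (e 0)) {r : ℕ} {d : ℝ[X]} {c : Fin r → ℝ[X]}
    (hper : ∀ k : ℕ, jacobiPolynomial V ((r + 1) * k + r)
      = jacobiPolynomial V r * (Chebyshev.S ℝ k).comp d)
    (hdiv : ∀ x y : ℝ, (x - y) * ((jacobiPolynomial V r).eval x +
      ∑ j, (c j).eval y * (jacobiPolynomial V j).eval x) = d.eval x - d.eval y) :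
    IsPeriodicSpectralMeasure μ (jacobiPolynomial V r) d
      (fun j : Fin r => jacobiPolynomial V j) c where
  bounded := by
    obtain ⟨R, hR⟩ := (spectrum.isCompact (𝕜 := ℝ) T).isBounded.subset_closedBall 0
    refine ⟨R, measure_mono_null ?_ hμ.null⟩
    intro x hx hxT
    have := hR hxT
    rw [Real.closedBall_eq_Icc, zero_sub, zero_add] at this
    exact hx this
  integral_sq k := by
    have h1 := h.integral_mul hT hμ r ((r + 1) * k + r)
    simp_rw [hper, eval_mul, eval_comp] at h1
    simp_rw [sq, mul_assoc]
    rw [h1]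
    congr 1
    simp
  integral_mul j k := by
    have h1 := h.integral_mul hT hμ j ((r + 1) * k + r)
    simp_rw [hper, eval_mul, eval_comp] at h1
    simp_rw [mul_assoc]
    rw [h1, if_neg]
    have := j.2
    have : r ≤ (r + 1) * k + r := Nat.le_add_left _ _
    omega
  divided_difference := hdiv

end IsJacobiChain

/-- Test with the distance to `K`: its functional calculus kills a total set, so it is zero, and the
distance vanishes on the spectrum. Nonemptiness matters because `Metric.infDist` to the empty set is
identically `0`. -/
theorem spectrum_subset_of_cfc_apply_eq_zero {T : H →L[ℂ] H} (hT : IsSelfAdjoint T) {s : Set H}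
    (hs : (Submodule.span ℂ s).topologicalClosure = ⊤) {K : Set ℝ} (hK : IsClosed K)
    (hne : K.Nonempty)
    (h : ∀ f : ℝ → ℝ, Continuous f → (∀ x ∈ K, f x = 0) → ∀ v ∈ s, cfc f T v = 0) :
    spectrum ℝ T ⊆ K := by
  have hc : Continuous fun x => Metric.infDist x K := Metric.continuous_infDist_pt K
  have h0 : cfc (fun x => Metric.infDist x K) T = cfc (0 : ℝ → ℝ) T := by
    rw [Pi.zero_def, cfc_const_zero]
    refine ContinuousLinearMap.ext_on (s := s) ?_ fun v hv => ?_
    · exact Submodule.dense_iff_topologicalClosure_eq_top.2 hs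
    · exact h _ hc (fun x hx => Metric.infDist_zero_of_mem hx) v hv
  have heq := eqOn_of_cfc_eq_cfc h0 hc.continuousOn continuousOn_const hT
  intro x hx
  exact (hK.mem_iff_infDist_zero hne).2 (heq hx)

/-- The part of the open interval outside the spectrum is open and `μ`-null, hence Lebesgue null,
hence empty; then take closures. -/
theorem IsPeriodicSpectralMeasure.Icc_subset_spectrum {T : H →L[ℂ] H} {e : H} {μ : Measure ℝ}
    (hμ : IsSpectralMeasure μ T e) {r : ℕ} {a d : ℝ[X]} {q c : Fin r → ℝ[X]}
    (h : IsPeriodicSpectralMeasure μ a d q c) (hd : d.derivative ≠ 0) {α β : ℝ} (hαβ : α < β)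
    (hinj : InjOn (fun x => d.eval x) (Icc α β))
    (hmem : ∀ x ∈ Icc α β, d.eval x ∈ Icc (-2 : ℝ) 2) : Icc α β ⊆ spectrum ℝ T := by
  have := hμ.isFiniteMeasure
  have hclosed : IsClosed (spectrum ℝ T) := spectrum.isClosed T
  have hopen : IsOpen (Ioo α β ∩ (spectrum ℝ T)ᶜ) := isOpen_Ioo.inter hclosed.isOpen_compl
  have hsub : Ioo α β ∩ (spectrum ℝ T)ᶜ ⊆ Icc α β := inter_subset_left.trans Ioo_subset_Icc_self
  have h0 := h.volume_eq_zero_of_measure hd hopen.measurableSet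
    (measure_mono_null inter_subset_right hμ.null) (B := |α| + |β|)
    (fun x hx => ⟨by linarith [(hsub hx).1, neg_abs_le α, abs_nonneg β],
      by linarith [(hsub hx).2, le_abs_self β, abs_nonneg α]⟩)
    (hinj.mono hsub) (fun x hx => hmem x (hsub hx))
  rw [hopen.measure_eq_zero_iff volume, ← sdiff_eq, sdiff_eq_empty] at h0
  rw [← closure_Ioo hαβ.ne]
  exact hclosed.closure_subset_iff.2 h0

end JacobiChain

/-! ### Adjacency operators on basis vectors and selfadjointness -/

section AdjacencyOperator

open scoped InnerProductSpace

theorem adjacencyOperator_apply {V : Type*} (G : SimpleGraph V) [G.LocallyFinite]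
    (hG : ∃ d : ℕ, ∀ v, G.degree v ≤ d) (f : EllTwo V) (v : V) :
    adjacencyOperator G hG f v = ∑ u ∈ G.neighborFinset v, f u := rfl

theorem adjacencyOperator_single {V : Type*} [DecidableEq V] (G : SimpleGraph V) [G.LocallyFinite]
    (hG : ∃ d : ℕ, ∀ v, G.degree v ≤ d) (v : V) :
    adjacencyOperator G hG (lp.single 2 v 1)
      = ∑ u ∈ G.neighborFinset v, (lp.single 2 u 1 : EllTwo V) := by
  ext w
  rw [adjacencyOperator_apply, lp.coeFn_sum, Finset.sum_apply]
  simp only [lp.single_apply, Pi.single_apply, Finset.sum_ite_eq', Finset.sum_ite_eq]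
  refine if_congr ?_ rfl rfl
  rw [G.mem_neighborFinset, G.mem_neighborFinset, G.adj_comm]

theorem isSelfAdjoint_adjacencyOperator {V : Type*} (G : SimpleGraph V) [G.LocallyFinite]
    (hG : ∃ d : ℕ, ∀ v, G.degree v ≤ d) : IsSelfAdjoint (adjacencyOperator G hG) := by
  classical
  rw [ContinuousLinearMap.isSelfAdjoint_iff']
  ext f v
  have h : ∀ (g : EllTwo V) (u : V), g u = ⟪(lp.single 2 u 1 : EllTwo V), g⟫_ℂ := by
    intro g u
    rw [lp.inner_single_left]
    simp
  rw [h, ContinuousLinearMap.adjoint_inner_right, adjacencyOperator_single, sum_inner,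
    adjacencyOperator_apply]
  exact Finset.sum_congr rfl fun u _ => (h f u).symm

end AdjacencyOperator

/-! ### Splitting the ladder into symmetric and antisymmetric Jacobi chains -/

section Ladder

open Polynomial
open scoped InnerProductSpace

theorem sum_neighborFinset_simonLadder_zero {M : Type*} [AddCommMonoid M] (Λ : Set ℕ)
    [DecidablePred (· ∈ Λ)] (φ : ℕ × Bool → M) (b : Bool) :
    ∑ u ∈ (simonLadder Λ).neighborFinset (0, b), φ u
      = φ (1, b) + if 1 ∈ Λ then φ (0, !b) else 0 := by
  have h : (simonLadder Λ).neighborFinset (0, b)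
      = {(1, b)} ∪ (if 1 ∈ Λ then {(0, !b)} else ∅) := by
    ext ⟨m, b'⟩
    rw [SimpleGraph.mem_neighborFinset]
    split_ifs with h <;> cases b <;> cases b' <;> simp [simonLadder, h, eq_comm]
  rw [h, Finset.sum_union]
  · split_ifs <;> simp
  · split_ifs <;> simp

theorem sum_neighborFinset_simonLadder_succ {M : Type*} [AddCommMonoid M] (Λ : Set ℕ)
    [DecidablePred (· ∈ Λ)] (φ : ℕ × Bool → M) (n : ℕ) (b : Bool) :
    ∑ u ∈ (simonLadder Λ).neighborFinset (n + 1, b), φ u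
      = φ (n + 2, b) + (if n + 2 ∈ Λ then φ (n + 1, !b) else 0) + φ (n, b) := by
  have h : (simonLadder Λ).neighborFinset (n + 1, b)
      = {(n + 2, b)} ∪ (if n + 2 ∈ Λ then {(n + 1, !b)} else ∅) ∪ {(n, b)} := by
    ext ⟨m, b'⟩
    rw [SimpleGraph.mem_neighborFinset]
    split_ifs with h <;> cases b <;> cases b' <;> simp [simonLadder, h] <;> omega
  rw [h, Finset.sum_union, Finset.sum_union]
  · split_ifs <;> simp
  · split_ifs <;> simp
  · split_ifs <;> simp

open Classical in
/-- The diagonal of the Jacobi matrix to which the ladder reduces on the functions with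
`f (n, true) = ε * f (n, false)`. -/
noncomputable def ladderPotential (Λ : Set ℕ) (ε : ℝ) (n : ℕ) : ℝ := if n + 1 ∈ Λ then ε else 0

/-- The normalized vector `δ (n, false) + ε δ (n, true)`. -/
noncomputable def ladderVector (ε : ℝ) (n : ℕ) : EllTwo (ℕ × Bool) :=
  ((√2 : ℝ) : ℂ)⁻¹ • (lp.single 2 (n, false) 1 + (ε : ℂ) • lp.single 2 (n, true) 1)

theorem ladderVector_apply (ε : ℝ) (n : ℕ) (v : ℕ × Bool) :
    ladderVector ε n v =
      if v.1 = n then ((√2 : ℝ) : ℂ)⁻¹ * (if v.2 then (ε : ℂ) else 1) else 0 := by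
  obtain ⟨m, b⟩ := v
  simp only [ladderVector, lp.coeFn_smul, lp.coeFn_add, Pi.smul_apply, Pi.add_apply,
    lp.single_apply, Pi.single_apply, Prod.mk.injEq, smul_eq_mul]
  cases b <;> by_cases h : m = n <;> simp [h]

theorem inner_ladderVector (ε : ℝ) (n : ℕ) (f : EllTwo (ℕ × Bool)) :
    ⟪ladderVector ε n, f⟫_ℂ = ((√2 : ℝ) : ℂ)⁻¹ * (f (n, false) + ε * f (n, true)) := by
  rw [ladderVector, inner_smul_left, inner_add_left, inner_smul_left, lp.inner_single_left,
    lp.inner_single_left]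
  simp

theorem inner_ladderVector_ladderVector (ε η : ℝ) (n m : ℕ) :
    ⟪ladderVector ε n, ladderVector η m⟫_ℂ = if n = m then (1 + ε * η : ℂ) / 2 else 0 := by
  rw [inner_ladderVector, ladderVector_apply, ladderVector_apply]
  have h2 : ((√2 : ℝ) : ℂ) ^ 2 = 2 := by norm_cast; norm_num
  have h0 : ((√2 : ℝ) : ℂ) ≠ 0 := by norm_cast; positivity
  by_cases h : n = m
  · simp only [h, if_true, Bool.false_eq_true, if_false]
    field_simp
    rw [h2]
    ring
  · simp [h]

/-- The rails carry position `n` to its neighbours, and a rung exchanges the two rails, which on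
these vectors is multiplication by `ε` because `ε² = 1`. -/
theorem isJacobiChain_ladder (Λ : Set ℕ) {ε : ℝ} (hε : ε ^ 2 = 1) :
    IsJacobiChain (simonLadderOperator Λ) (ladderPotential Λ ε) (ladderVector ε) := by
  classical
  have hε' : (ε : ℂ) * ε = 1 := by rw [← sq]; exact_mod_cast hε
  refine ⟨?_, ?_, fun n => ?_⟩
  · rw [orthonormal_iff_ite]
    intro n m
    rw [inner_ladderVector_ladderVector, hε']
    norm_num
  · rw [ladderVector, simonLadderOperator, map_smul, map_add, map_smul, adjacencyOperator_single,
      adjacencyOperator_single, sum_neighborFinset_simonLadder_zero,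
      sum_neighborFinset_simonLadder_zero, ladderVector, ladderPotential, zero_add]
    split_ifs with h
    · simp only [smul_add, smul_smul, Bool.not_false, Bool.not_true]
      rw [show (ε : ℂ) * (((√2 : ℝ) : ℂ)⁻¹ * ε) = ((√2 : ℝ) : ℂ)⁻¹ by
        linear_combination ((√2 : ℝ) : ℂ)⁻¹ * hε', mul_comm (ε : ℂ)]
      abel
    · simp
  · rw [ladderVector, simonLadderOperator, map_smul, map_add, map_smul, adjacencyOperator_single,
      adjacencyOperator_single, sum_neighborFinset_simonLadder_succ,
      sum_neighborFinset_simonLadder_succ, ladderVector, ladderVector, ladderPotential]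
    split_ifs with h
    · simp only [smul_add, smul_smul, Bool.not_false, Bool.not_true]
      rw [show (ε : ℂ) * (((√2 : ℝ) : ℂ)⁻¹ * ε) = ((√2 : ℝ) : ℂ)⁻¹ by
        linear_combination ((√2 : ℝ) : ℂ)⁻¹ * hε', mul_comm (ε : ℂ)]
      abel
    · simp only [smul_add, smul_smul, Complex.ofReal_zero, zero_mul, zero_smul, add_zero]
      abel

theorem isSelfAdjoint_simonLadderOperator (Λ : Set ℕ) : IsSelfAdjoint (simonLadderOperator Λ) :=
  isSelfAdjoint_adjacencyOperator _ _

theorem eq_zero_of_inner_ladderVector {f : EllTwo (ℕ × Bool)}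
    (h₁ : ∀ n, ⟪ladderVector 1 n, f⟫_ℂ = 0) (h₂ : ∀ n, ⟪ladderVector (-1) n, f⟫_ℂ = 0) : f = 0 := by
  have h0 : ((√2 : ℝ) : ℂ)⁻¹ ≠ 0 := inv_ne_zero (by norm_cast; positivity)
  simp only [inner_ladderVector, mul_eq_zero, h0, false_or] at h₁ h₂
  ext ⟨n, b⟩
  have e₁ := h₁ n
  have e₂ := h₂ n
  push_cast at e₁ e₂
  cases b
  · show f (n, false) = 0
    linear_combination (e₁ + e₂) / 2
  · show f (n, true) = 0
    linear_combination (e₁ - e₂) / 2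

theorem ladderVector_total :
    (Submodule.span ℂ (range (ladderVector 1) ∪ range (ladderVector (-1)))).topologicalClosure
      = ⊤ := by
  rw [Submodule.topologicalClosure_eq_top_iff, Submodule.eq_bot_iff]
  intro f hf
  rw [Submodule.mem_orthogonal] at hf
  exact eq_zero_of_inner_ladderVector
    (fun n => hf _ (Submodule.subset_span (Or.inl ⟨n, rfl⟩)))
    (fun n => hf _ (Submodule.subset_span (Or.inr ⟨n, rfl⟩)))

end Ladder

/-! ### The model space for a sum of two cyclic operators -/

section HahnHellinger

open Polynomial
open scoped InnerProductSpace

/-- Taking the square root `s` of the Radon–Nikodym derivative makes `f ↦ s f` an isometry from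
`L²(ν)` into `L²(μ)`. -/
theorem exists_sq_density {μ ν : Measure ℝ} [IsFiniteMeasure μ] [IsFiniteMeasure ν] (h : ν ≪ μ) :
    ∃ s : ℝ → ℝ, Measurable s ∧ ν = μ.withDensity fun x => ENNReal.ofReal (s x ^ 2) := by
  refine ⟨fun x => √(ν.rnDeriv μ x).toReal, by fun_prop, ?_⟩
  rw [← Measure.withDensity_rnDeriv_eq ν μ h]
  refine withDensity_congr_ae ?_
  filter_upwards [Measure.rnDeriv_lt_top ν μ,
    Measure.rnDeriv_withDensity μ (Measure.measurable_rnDeriv ν μ)] with x hx hx2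
  rw [hx2, Real.sq_sqrt ENNReal.toReal_nonneg, ENNReal.ofReal_toReal hx.ne]

theorem exists_mul_operator {ν : Measure ℝ} {R : ℝ} (hR : ∀ᵐ x ∂ν, x ∈ Icc (-R) R) :
    ∃ M : Lp ℂ 2 ν →L[ℂ] Lp ℂ 2 ν, ∀ f, M f =ᵐ[ν] fun x => (x : ℂ) * f x := by
  have hx : MemLp (fun x : ℝ => (x : ℂ)) ∞ ν := by
    refine memLp_top_of_bound Complex.measurable_ofReal.aestronglyMeasurable R ?_
    filter_upwards [hR] with x hx
    rw [Complex.norm_real]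
    exact abs_le.2 hx
  refine ⟨(ContinuousLinearMap.mul ℂ ℂ).holderL ν ∞ 2 2 (hx.toLp _), fun f => ?_⟩
  refine ((ContinuousLinearMap.mul ℂ ℂ).coeFn_holder (hx.toLp _) f).trans ?_
  filter_upwards [hx.coeFn_toLp] with x h
  rw [h]
  rfl

section Weight

variable {μ ν : Measure ℝ} {s : ℝ → ℝ}

theorem integral_eq_integral_sq_mul (hs : Measurable s)
    (hν : ν = μ.withDensity fun x => ENNReal.ofReal (s x ^ 2)) (f : ℝ → ℝ) :
    ∫ x, f x ∂ν = ∫ x, s x ^ 2 * f x ∂μ := by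
  rw [hν, integral_withDensity_eq_integral_toReal_smul (by fun_prop) (by simp)]
  congr 1 with x
  rw [ENNReal.toReal_ofReal (sq_nonneg _), smul_eq_mul]

theorem memLp_weight_mul_polynomial [IsFiniteMeasure ν] (hs : Measurable s)
    (hν : ν = μ.withDensity fun x => ENNReal.ofReal (s x ^ 2)) {R : ℝ}
    (hR : ∀ᵐ x ∂ν, x ∈ Icc (-R) R) (P : ℝ[X]) :
    MemLp (fun x => ((s x * P.eval x : ℝ) : ℂ)) 2 μ := by
  have hP := P.continuous.measurable
  rw [memLp_two_iff_integrable_sq_norm (by fun_prop)]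
  have h1 := integrable_polynomial_comp (d := fun x => x) measurable_id hR (P * P)
  rw [hν, integrable_withDensity_iff_integrable_smul' (by fun_prop) (by simp)] at h1
  refine h1.congr (Filter.Eventually.of_forall fun x => ?_)
  dsimp only
  rw [ENNReal.toReal_ofReal (sq_nonneg _), smul_eq_mul, Complex.norm_real, Real.norm_eq_abs, sq_abs,
    eval_mul]
  ring

theorem measure_eq_zero_of_density_eq_zero
    (hν : ν = μ.withDensity fun x => ENNReal.ofReal (s x ^ 2)) (hs : Measurable s) :
    ν {x | s x = 0} = 0 := by
  have hm : MeasurableSet {x | s x = 0} := hs (measurableSet_singleton 0)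
  rw [hν, withDensity_apply _ hm, lintegral_eq_zero_iff (by fun_prop)]
  filter_upwards [ae_restrict_mem hm] with x hx
  have : s x = 0 := hx
  simp [this]

theorem measure_inter_eq_zero_of_density
    (hν : ν = μ.withDensity fun x => ENNReal.ofReal (s x ^ 2)) (hs : Measurable s) {A : Set ℝ}
    (hA : ν A = 0) : μ (A ∩ {x | s x ≠ 0}) = 0 := by
  rw [hν, withDensity_apply_eq_zero (by fun_prop)] at hA
  refine measure_mono_null ?_ hA
  rintro x ⟨hx, hsx⟩
  have h : 0 < s x ^ 2 := by have : s x ≠ 0 := hsx; positivity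
  exact ⟨(ENNReal.ofReal_pos.2 h).ne', hx⟩

end Weight

open Classical in
/-- The multiplicity function of a sum of two cyclic operators whose spectral measures have
densities `s ^ 2` and `t ^ 2`. -/
noncomputable def pairMultiplicity (s t : ℝ → ℝ) (x : ℝ) : ℕ∞ :=
  if s x ≠ 0 ∧ t x ≠ 0 then 2 else 1

theorem setOf_zero_lt_pairMultiplicity (s t : ℝ → ℝ) :
    {x | ((0 : ℕ) : ℕ∞) < pairMultiplicity s t x} = univ := by
  ext x
  simp only [pairMultiplicity, mem_ofPred_eq, mem_univ, iff_true]
  split_ifs <;> simp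

theorem setOf_one_lt_pairMultiplicity (s t : ℝ → ℝ) :
    {x | ((1 : ℕ) : ℕ∞) < pairMultiplicity s t x} = {x | s x ≠ 0 ∧ t x ≠ 0} := by
  ext x
  simp only [pairMultiplicity, mem_ofPred_eq]
  split_ifs with h <;> simp [h]

theorem setOf_add_two_lt_pairMultiplicity (s t : ℝ → ℝ) (n : ℕ) :
    {x | ((n + 2 : ℕ) : ℕ∞) < pairMultiplicity s t x} = ∅ := by
  ext x
  simp only [pairMultiplicity, mem_ofPred_eq, mem_empty_iff_false, iff_false, not_lt]
  have h2 : (2 : ℕ∞) ≤ ((n + 2 : ℕ) : ℕ∞) := by exact_mod_cast Nat.le_add_left 2 n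
  split_ifs
  · exact h2
  · exact le_trans (by norm_num) h2

theorem measurableSet_setOf_lt_pairMultiplicity {s t : ℝ → ℝ} (hs : Measurable s)
    (ht : Measurable t) (n : ℕ) : MeasurableSet {x | (n : ℕ∞) < pairMultiplicity s t x} := by
  rcases n with _ | _ | n
  · rw [setOf_zero_lt_pairMultiplicity]; exact MeasurableSet.univ
  · rw [zero_add, setOf_one_lt_pairMultiplicity]
    exact (hs (measurableSet_singleton 0)).compl.inter (ht (measurableSet_singleton 0)).compl
  · rw [setOf_add_two_lt_pairMultiplicity]; exact MeasurableSet.empty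

/-- The space on which the Hahn–Hellinger form of a sum of two cyclic operators acts. -/
abbrev PairSpace (μ : Measure ℝ) (s t : ℝ → ℝ) : Type _ :=
  lp (fun n : ℕ => Lp ℂ 2 (μ.restrict {x | (n : ℕ∞) < pairMultiplicity s t x})) 2

section PairSpace

variable {μ : Measure ℝ} {s t : ℝ → ℝ}

/-- The element of `PairSpace μ s t` with the single component `u`, at the index `n`. -/
noncomputable def pairSingle (s t : ℝ → ℝ) (n : ℕ) {u : ℝ → ℂ} (hu : MemLp u 2 μ) :
    PairSpace μ s t :=
  lp.single 2 n ((hu.restrict {x | (n : ℕ∞) < pairMultiplicity s t x}).toLp u)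

theorem pairSingle_apply_self (n : ℕ) {u : ℝ → ℂ} (hu : MemLp u 2 μ) :
    pairSingle s t n hu n =ᵐ[μ.restrict {x | (n : ℕ∞) < pairMultiplicity s t x}] u := by
  rw [pairSingle, lp.single_apply_self]
  exact MemLp.coeFn_toLp _

theorem pairSingle_apply_of_ne {n k : ℕ} (h : k ≠ n) {u : ℝ → ℂ} (hu : MemLp u 2 μ) :
    pairSingle s t n hu k = 0 := by
  rw [pairSingle, lp.single_apply_ne _ _ _ h]

theorem inner_pairSingle (n : ℕ) {u : ℝ → ℂ} (hu : MemLp u 2 μ) (F : PairSpace μ s t) :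
    ⟪pairSingle s t n hu, F⟫_ℂ
      = ∫ x in {x | (n : ℕ∞) < pairMultiplicity s t x}, starRingEnd ℂ (u x) * F n x ∂μ := by
  rw [pairSingle, lp.inner_single_left, L2.inner_def]
  refine integral_congr_ae ?_
  filter_upwards [(hu.restrict {x | (n : ℕ∞) < pairMultiplicity s t x}).coeFn_toLp] with x hx
  rw [hx, RCLike.inner_apply, mul_comm]

theorem inner_pairSingle_self (n : ℕ) {u v : ℝ → ℂ} (hu : MemLp u 2 μ) (hv : MemLp v 2 μ) :
    ⟪pairSingle s t n hu, pairSingle s t n hv⟫_ℂ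
      = ∫ x in {x | (n : ℕ∞) < pairMultiplicity s t x}, starRingEnd ℂ (u x) * v x ∂μ := by
  rw [inner_pairSingle]
  refine integral_congr_ae ?_
  filter_upwards [pairSingle_apply_self (s := s) (t := t) n hv] with x hx
  rw [hx]

theorem inner_pairSingle_of_ne {n k : ℕ} (h : n ≠ k) {u v : ℝ → ℂ} (hu : MemLp u 2 μ)
    (hv : MemLp v 2 μ) : ⟪pairSingle s t n hu, pairSingle s t k hv⟫_ℂ = 0 := by
  rw [pairSingle, lp.inner_single_left, pairSingle_apply_of_ne h, inner_zero_right]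

end PairSpace

end HahnHellinger

/-! ### Embedding the two cyclic subspaces into the model space -/

section HahnHellingerPair

open Polynomial
open scoped InnerProductSpace

variable {μ : Measure ℝ} {s t : ℝ → ℝ}

theorem pairSingle_add_smul (n : ℕ) {u v w : ℝ → ℂ} (hu : MemLp u 2 μ) (hv : MemLp v 2 μ)
    (hw : MemLp w 2 μ) (c : ℂ) (h : w = u + c • v) :
    pairSingle s t n hw = pairSingle s t n hu + c • pairSingle s t n hv := by
  subst h
  rw [pairSingle, pairSingle, pairSingle, ← lp.single_smul, ← lp.single_add,
    ← MemLp.toLp_const_smul, ← MemLp.toLp_add]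

theorem setIntegral_zero_lt_pairMultiplicity (g : ℝ → ℂ) :
    ∫ x in {x | ((0 : ℕ) : ℕ∞) < pairMultiplicity s t x}, g x ∂μ = ∫ x, g x ∂μ := by
  rw [setOf_zero_lt_pairMultiplicity, Measure.restrict_univ]

theorem setIntegral_one_lt_pairMultiplicity (hs : Measurable s) (ht : Measurable t) (g : ℝ → ℂ) :
    ∫ x in {x | ((1 : ℕ) : ℕ∞) < pairMultiplicity s t x}, g x ∂μ
      = ∫ x, indicator {x | s x ≠ 0 ∧ t x ≠ 0} g x ∂μ := by
  rw [setOf_one_lt_pairMultiplicity, integral_indicator]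
  exact (hs (measurableSet_singleton 0)).compl.inter (ht (measurableSet_singleton 0)).compl

/-- The image of the polynomial `P` in the first cyclic subspace. -/
noncomputable def pairFirst (t : ℝ → ℝ)
    (h : ∀ P : ℝ[X], MemLp (fun x => ((s x * P.eval x : ℝ) : ℂ)) 2 μ) (P : ℝ[X]) :
    PairSpace μ s t :=
  pairSingle s t 0 (h P)

/-- The image of the polynomial `P` in the second cyclic subspace. -/
noncomputable def pairSecond (hs : Measurable s)
    (h : ∀ P : ℝ[X], MemLp (fun x => ((t x * P.eval x : ℝ) : ℂ)) 2 μ) (P : ℝ[X]) :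
    PairSpace μ s t :=
  pairSingle s t 0 ((h P).indicator (hs (measurableSet_singleton 0))) + pairSingle s t 1 (h P)

section Algebra

variable (hs : Measurable s) (h₁ : ∀ P : ℝ[X], MemLp (fun x => ((s x * P.eval x : ℝ) : ℂ)) 2 μ)
  (h₂ : ∀ P : ℝ[X], MemLp (fun x => ((t x * P.eval x : ℝ) : ℂ)) 2 μ)

theorem pairFirst_add_C_mul (P Q : ℝ[X]) (c : ℝ) :
    pairFirst t h₁ (P + C c * Q) = pairFirst t h₁ P + (c : ℂ) • pairFirst t h₁ Q := by
  refine pairSingle_add_smul 0 _ _ _ _ ?_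
  ext x
  simp
  ring

theorem pairSecond_add_C_mul (P Q : ℝ[X]) (c : ℝ) :
    pairSecond hs h₂ (P + C c * Q) = pairSecond hs h₂ P + (c : ℂ) • pairSecond hs h₂ Q := by
  have e : (fun x => ((t x * (P + C c * Q).eval x : ℝ) : ℂ)) = (fun x => ((t x * P.eval x : ℝ) : ℂ))
      + (c : ℂ) • fun x => ((t x * Q.eval x : ℝ) : ℂ) := by
    ext x
    simp
    ring
  rw [pairSecond, pairSingle_add_smul 0 ((h₂ P).indicator (hs (measurableSet_singleton 0)))
      ((h₂ Q).indicator (hs (measurableSet_singleton 0))) _ c,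
    pairSingle_add_smul 1 (h₂ P) (h₂ Q) _ c e, pairSecond, pairSecond, smul_add]
  · abel
  · rw [e]
    ext x
    by_cases hx : x ∈ s ⁻¹' {0}
    · simp only [Pi.add_apply, Pi.smul_apply, indicator_of_mem hx]
    · simp only [Pi.add_apply, Pi.smul_apply, indicator_of_notMem hx, smul_zero, add_zero]

theorem pairFirst_X_mul (P : ℝ[X]) (n : ℕ) :
    pairFirst t h₁ (X * P) n =ᵐ[μ.restrict {x | (n : ℕ∞) < pairMultiplicity s t x}]
      fun x => (x : ℂ) * pairFirst t h₁ P n x := by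
  by_cases hn : n = 0
  · subst hn
    filter_upwards [pairSingle_apply_self (s := s) (t := t) 0 (h₁ (X * P)),
      pairSingle_apply_self (s := s) (t := t) 0 (h₁ P)] with x e₁ e₂
    rw [pairFirst, pairFirst, e₁, e₂]
    simp
    ring
  · rw [pairFirst, pairFirst, pairSingle_apply_of_ne hn, pairSingle_apply_of_ne hn]
    filter_upwards [Lp.coeFn_zero ℂ 2 (μ.restrict {x | (n : ℕ∞) < pairMultiplicity s t x})] with x e
    rw [e]
    simp

theorem pairSecond_X_mul (P : ℝ[X]) (n : ℕ) :
    pairSecond hs h₂ (X * P) n =ᵐ[μ.restrict {x | (n : ℕ∞) < pairMultiplicity s t x}]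
      fun x => (x : ℂ) * pairSecond hs h₂ P n x := by
  have hm := hs (measurableSet_singleton 0)
  rw [pairSecond, pairSecond, lp.coeFn_add, lp.coeFn_add, Pi.add_apply, Pi.add_apply]
  by_cases h0 : n = 0
  · subst h0
    rw [pairSingle_apply_of_ne (zero_ne_one) (h₂ (X * P)),
      pairSingle_apply_of_ne (zero_ne_one) (h₂ P), add_zero, add_zero]
    filter_upwards [pairSingle_apply_self (s := s) (t := t) 0 ((h₂ (X * P)).indicator hm),
      pairSingle_apply_self (s := s) (t := t) 0 ((h₂ P).indicator hm)] with x e₁ e₂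
    rw [e₁, e₂]
    by_cases hx : x ∈ s ⁻¹' {0}
    · simp only [indicator_of_mem hx]
      simp
      ring
    · simp only [indicator_of_notMem hx, mul_zero]
  · rw [pairSingle_apply_of_ne h0, pairSingle_apply_of_ne h0, zero_add, zero_add]
    by_cases h1 : n = 1
    · subst h1
      filter_upwards [pairSingle_apply_self (s := s) (t := t) 1 (h₂ (X * P)),
        pairSingle_apply_self (s := s) (t := t) 1 (h₂ P)] with x e₁ e₂
      rw [e₁, e₂]
      simp
      ring
    · rw [pairSingle_apply_of_ne h1, pairSingle_apply_of_ne h1]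
      filter_upwards [Lp.coeFn_zero ℂ 2 (μ.restrict {x | (n : ℕ∞) < pairMultiplicity s t x})]
        with x e
      rw [e]
      simp

theorem inner_pairFirst_pairFirst (P Q : ℝ[X]) :
    ⟪pairFirst t h₁ P, pairFirst t h₁ Q⟫_ℂ
      = ((∫ x, s x ^ 2 * (P.eval x * Q.eval x) ∂μ : ℝ) : ℂ) := by
  rw [pairFirst, pairFirst, inner_pairSingle_self, setOf_zero_lt_pairMultiplicity,
    Measure.restrict_univ, ← integral_complex_ofReal]
  congr 1 with x
  rw [Complex.conj_ofReal]
  push_cast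
  ring

/-- In component `0` the first image carries the factor `s` and the second is cut off to `{s = 0}`;
component `1` contains only the second. -/
theorem inner_pairFirst_pairSecond (P Q : ℝ[X]) :
    ⟪pairFirst t h₁ P, pairSecond hs h₂ Q⟫_ℂ = 0 := by
  rw [pairFirst, pairSecond, inner_add_right, inner_pairSingle_of_ne zero_ne_one, add_zero,
    inner_pairSingle_self]
  refine integral_eq_zero_of_ae (Filter.Eventually.of_forall fun x => ?_)
  by_cases hx : s x = 0
  · simp [hx]
  · have hx' : x ∉ s ⁻¹' {0} := hx
    simp only [indicator_of_notMem hx', mul_zero]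
    rfl

/-- The weight `t²` is split between `{s = 0}`, in component `0`, and `{s ≠ 0, t ≠ 0}`, in component
`1`. The rest of the line has `t = 0` and contributes nothing. -/
theorem inner_pairSecond_pairSecond (ht : Measurable t) (P Q : ℝ[X]) :
    ⟪pairSecond hs h₂ P, pairSecond hs h₂ Q⟫_ℂ
      = ((∫ x, t x ^ 2 * (P.eval x * Q.eval x) ∂μ : ℝ) : ℂ) := by
  have hm := hs (measurableSet_singleton 0)
  have hS : MeasurableSet {x | s x ≠ 0 ∧ t x ≠ 0} :=
    hm.compl.inter (ht (measurableSet_singleton 0)).compl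
  have hi : Integrable (fun x => starRingEnd ℂ ((t x * P.eval x : ℝ) : ℂ) *
      ((t x * Q.eval x : ℝ) : ℂ)) μ := by
    simp_rw [Complex.conj_ofReal]
    exact (h₂ P).integrable_mul (h₂ Q)
  rw [pairSecond, pairSecond, inner_add_left, inner_add_right, inner_add_right,
    inner_pairSingle_of_ne zero_ne_one, inner_pairSingle_of_ne one_ne_zero, zero_add, add_zero,
    inner_pairSingle_self, inner_pairSingle_self, setIntegral_zero_lt_pairMultiplicity,
    setIntegral_one_lt_pairMultiplicity hs ht, ← integral_complex_ofReal, ← integral_add]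
  · congr 1 with x
    by_cases hx : s x = 0
    · have hx' : x ∈ s ⁻¹' {0} := hx
      rw [indicator_of_mem hx', indicator_of_mem hx', indicator_of_notMem (fun h => h.1 hx),
        Complex.conj_ofReal]
      push_cast
      ring
    · have hx' : x ∉ s ⁻¹' {0} := hx
      rw [indicator_of_notMem hx', indicator_of_notMem hx', mul_zero, zero_add]
      by_cases hx2 : t x = 0
      · rw [indicator_of_notMem (fun h => h.2 hx2), hx2]
        simp
      · rw [indicator_of_mem (show x ∈ {x | s x ≠ 0 ∧ t x ≠ 0} from ⟨hx, hx2⟩), Complex.conj_ofReal]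
        push_cast
        ring
  · refine (hi.indicator hm).congr (Filter.Eventually.of_forall fun x => ?_)
    by_cases hx : x ∈ s ⁻¹' {0}
    · simp only [indicator_of_mem hx]
    · simp only [indicator_of_notMem hx, mul_zero]
  · exact hi.indicator hS

/-- Orthogonality to all polynomials gives, almost everywhere, `s F₀ = 0` and `t (1_{s=0} F₀ +
1_{s,t≠0} F₁) = 0`. As `s` and `t` have almost no common zeros, `F₀` and `F₁` vanish; the later
components live on the empty set. -/
theorem pairSpace_eq_zero (ht : Measurable t) {R : ℝ} (hR : ∀ᵐ x ∂μ, x ∈ Icc (-R) R)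
    (hst : μ {x | s x = 0 ∧ t x = 0} = 0) {F : PairSpace μ s t}
    (hF₁ : ∀ P, ⟪pairFirst t h₁ P, F⟫_ℂ = 0) (hF₂ : ∀ P, ⟪pairSecond hs h₂ P, F⟫_ℂ = 0) :
    F = 0 := by
  have hm := hs (measurableSet_singleton 0)
  have hS : MeasurableSet {x | s x ≠ 0 ∧ t x ≠ 0} :=
    hm.compl.inter (ht (measurableSet_singleton 0)).compl
  have hL0 : MemLp (F 0) 2 μ := by
    have h : ∀ g : ℝ → ℂ, MemLp g 2 (μ.restrict {x | ((0 : ℕ) : ℕ∞) < pairMultiplicity s t x}) →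
        MemLp g 2 μ := by
      intro g
      rw [setOf_zero_lt_pairMultiplicity, Measure.restrict_univ]
      exact id
    exact h _ (Lp.memLp (F 0))
  have hL1 : MemLp (indicator {x | s x ≠ 0 ∧ t x ≠ 0} (F 1)) 2 μ := by
    have h : ∀ g : ℝ → ℂ, MemLp g 2 (μ.restrict {x | ((1 : ℕ) : ℕ∞) < pairMultiplicity s t x}) →
        MemLp (indicator {x | s x ≠ 0 ∧ t x ≠ 0} g) 2 μ := by
      intro g
      rw [setOf_one_lt_pairMultiplicity, memLp_indicator_iff_restrict hS]
      exact id
    exact h _ (Lp.memLp (F 1))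
  have hs1 : MemLp (fun x => (s x : ℂ)) 2 μ := by simpa using h₁ 1
  have ht1 : MemLp (fun x => (t x : ℂ)) 2 μ := by simpa using h₂ 1
  have e₁ : (fun x => (s x : ℂ) * F 0 x) =ᵐ[μ] 0 := by
    refine ae_eq_zero_of_integral_mul_polynomial (hs1.integrable_mul hL0) hR fun P => ?_
    rw [← hF₁ P, pairFirst, inner_pairSingle, setIntegral_zero_lt_pairMultiplicity]
    congr 1 with x
    rw [Complex.conj_ofReal]
    push_cast
    simp only [Complex.coe_algebraMap]
    ring
  have e₂ : (fun x => (s ⁻¹' {0}).indicator (fun x => (t x : ℂ)) x * F 0 x +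
      (t x : ℂ) * indicator {x | s x ≠ 0 ∧ t x ≠ 0} (F 1) x) =ᵐ[μ] 0 := by
    have i₁ := (ht1.indicator hm).integrable_mul hL0
    have i₂ := ht1.integrable_mul hL1
    refine ae_eq_zero_of_integral_mul_polynomial (i₁.add i₂) hR fun P => ?_
    have j₁ := ((h₂ P).indicator hm).integrable_mul hL0
    have j₂ := (h₂ P).integrable_mul hL1
    rw [← hF₂ P, pairSecond, inner_add_left, inner_pairSingle, inner_pairSingle,
      setIntegral_zero_lt_pairMultiplicity, setIntegral_one_lt_pairMultiplicity hs ht,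
      ← integral_add]
    · congr 1 with x
      by_cases hx : x ∈ s ⁻¹' {0}
      · have hx2 : x ∉ {x | s x ≠ 0 ∧ t x ≠ 0} := fun h => h.1 hx
        simp only [indicator_of_mem hx, indicator_of_notMem hx2,
          Complex.conj_ofReal]
        push_cast
        simp only [Complex.coe_algebraMap]
        ring
      · by_cases hx2 : x ∈ {x | s x ≠ 0 ∧ t x ≠ 0}
        · simp only [indicator_of_mem hx2, indicator_of_notMem hx,
            Complex.conj_ofReal, map_zero]
          push_cast
          simp only [Complex.coe_algebraMap]
          ring
        · simp [indicator_of_notMem hx2, indicator_of_notMem hx]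
    · refine j₁.congr (Filter.Eventually.of_forall fun x => ?_)
      by_cases hx : x ∈ s ⁻¹' {0}
      · simp only [indicator_of_mem hx, Complex.conj_ofReal, Pi.mul_apply]
      · simp [indicator_of_notMem hx]
    · refine j₂.congr (Filter.Eventually.of_forall fun x => ?_)
      by_cases hx : x ∈ {x | s x ≠ 0 ∧ t x ≠ 0}
      · simp only [indicator_of_mem hx, Complex.conj_ofReal, Pi.mul_apply]
      · simp [indicator_of_notMem hx]
  have hst' : ∀ᵐ x ∂μ, ¬ (s x = 0 ∧ t x = 0) := by rw [ae_iff]; simpa using hst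
  refine lp.ext (funext fun n => ?_)
  change F n = 0
  rw [Lp.eq_zero_iff_ae_eq_zero]
  rcases n with _ | _ | n
  · refine ae_restrict_of_ae ?_
    filter_upwards [e₁, e₂, hst'] with x h1 h2 h3
    by_cases hx : s x = 0
    · have ht0 : (t x : ℂ) ≠ 0 := by exact_mod_cast fun h => h3 ⟨hx, h⟩
      have hx' : x ∈ s ⁻¹' {0} := hx
      have hx2 : x ∉ {x | s x ≠ 0 ∧ t x ≠ 0} := fun h => h.1 hx
      rw [indicator_of_mem hx', indicator_of_notMem hx2, mul_zero, add_zero] at h2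
      exact (mul_eq_zero.1 h2).resolve_left ht0
    · exact (mul_eq_zero.1 h1).resolve_left (by exact_mod_cast hx)
  · have h : ∀ᵐ x ∂μ.restrict {x | s x ≠ 0 ∧ t x ≠ 0}, F 1 x = 0 := by
      filter_upwards [ae_restrict_of_ae e₂, ae_restrict_mem hS] with x h2 hx
      have hx' : x ∉ s ⁻¹' {0} := hx.1
      have hx2 : x ∈ {x | s x ≠ 0 ∧ t x ≠ 0} := hx
      rw [indicator_of_mem hx2, indicator_of_notMem hx', zero_mul, zero_add] at h2
      exact (mul_eq_zero.1 h2).resolve_left (by exact_mod_cast hx.2)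
    rw [← setOf_one_lt_pairMultiplicity] at h
    exact h
  · have h : μ.restrict {x | ((n + 2 : ℕ) : ℕ∞) < pairMultiplicity s t x} = 0 := by
      rw [setOf_add_two_lt_pairMultiplicity, Measure.restrict_empty]
    exact measure_mono_null (subset_univ _) (Measure.measure_univ_eq_zero.2 h)

end Algebra

end HahnHellingerPair

/-! ### The Hahn–Hellinger form of two orthogonal Jacobi chains -/

section HahnHellingerChains

open Polynomial
open scoped InnerProductSpace

theorem orthonormal_sumElim {E : Type*} [NormedAddCommGroup E] [InnerProductSpace ℂ E]
    {ι κ : Type*} {v : ι → E} {w : κ → E} (hv : Orthonormal ℂ v) (hw : Orthonormal ℂ w)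
    (h : ∀ i j, ⟪v i, w j⟫_ℂ = 0) : Orthonormal ℂ (Sum.elim v w) := by
  refine ⟨?_, ?_⟩
  · rintro (i | j)
    exacts [hv.1 i, hw.1 j]
  · rintro (i | i) (j | j) hij
    · exact hv.2 fun hij' => hij (hij' ▸ rfl)
    · exact h i j
    · exact inner_eq_zero_symm.1 (h j i)
    · exact hw.2 fun hij' => hij (hij' ▸ rfl)

theorem orthogonal_span_sumElim_eq_bot {E : Type*} [NormedAddCommGroup E] [InnerProductSpace ℂ E]
    {ι κ : Type*} {v : ι → E} {w : κ → E}
    (h : ∀ f, (∀ i, ⟪v i, f⟫_ℂ = 0) → (∀ j, ⟪w j, f⟫_ℂ = 0) → f = 0) :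
    (Submodule.span ℂ (range (Sum.elim v w)))ᗮ = ⊥ := by
  rw [Submodule.eq_bot_iff]
  intro f hf
  rw [Submodule.mem_orthogonal] at hf
  exact h f (fun i => hf _ (Submodule.subset_span ⟨Sum.inl i, rfl⟩))
    (fun j => hf _ (Submodule.subset_span ⟨Sum.inr j, rfl⟩))

variable {H : Type*} [NormedAddCommGroup H] [InnerProductSpace ℂ H]

/-- The recursion for `T` on the chain is the recursion for `X` on the polynomials, so `T` becomes
multiplication by `X`. -/
theorem IsJacobiChain.map_apply {E : Type*} [NormedAddCommGroup E] [InnerProductSpace ℂ E]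
    {T : H →L[ℂ] H} {V : ℕ → ℝ} {e : ℕ → H} (h : IsJacobiChain T V e)
    (U : H ≃ₗᵢ[ℂ] E) {Φ : ℝ[X] → E}
    (hΦ : ∀ (P Q : ℝ[X]) (c : ℝ), Φ (P + C c * Q) = Φ P + (c : ℂ) • Φ Q)
    (hU : ∀ n, U (e n) = Φ (jacobiPolynomial V n)) (n : ℕ) :
    U (T (e n)) = Φ (X * jacobiPolynomial V n) := by
  rcases n with _ | n
  · rw [h.apply_zero, X_mul_jacobiPolynomial_zero, hΦ, map_add, map_smul, hU, hU]
  · have h1 : jacobiPolynomial V n = C 1 * jacobiPolynomial V n := by simp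
    rw [h.apply_succ, X_mul_jacobiPolynomial_succ, h1, hΦ, hΦ, map_add, map_add, map_smul, hU, hU,
      hU, Complex.ofReal_one, one_smul]

variable [CompleteSpace H]

/-- The chains form a Hilbert basis of `H`, and their orthogonal polynomials, placed in the model
space, form one there. The unitary `U` matches these bases. -/
theorem isHahnHellingerForm_of_isJacobiChain {T : H →L[ℂ] H} (hT : IsSelfAdjoint T)
    {V₁ V₂ : ℕ → ℝ} {e₁ e₂ : ℕ → H} (h₁ : IsJacobiChain T V₁ e₁) (h₂ : IsJacobiChain T V₂ e₂)
    (hcross : ∀ m n, ⟪e₁ m, e₂ n⟫_ℂ = 0)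
    (htotal : ∀ f, (∀ n, ⟪e₁ n, f⟫_ℂ = 0) → (∀ n, ⟪e₂ n, f⟫_ℂ = 0) → f = 0)
    {μ₁ μ₂ : Measure ℝ} (hμ₁ : IsSpectralMeasure μ₁ T (e₁ 0)) (hμ₂ : IsSpectralMeasure μ₂ T (e₂ 0))
    {s t : ℝ → ℝ} (hs : Measurable s) (ht : Measurable t)
    (hsμ : μ₁ = (μ₁ + μ₂).withDensity fun x => ENNReal.ofReal (s x ^ 2))
    (htμ : μ₂ = (μ₁ + μ₂).withDensity fun x => ENNReal.ofReal (t x ^ 2)) :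
    IsHahnHellingerForm T (μ₁ + μ₂) (pairMultiplicity s t) := by
  have := hμ₁.isFiniteMeasure
  have := hμ₂.isFiniteMeasure
  obtain ⟨R, hR⟩ : ∃ R, spectrum ℝ T ⊆ Icc (-R) R := by
    obtain ⟨R, hR⟩ := (spectrum.isCompact (𝕜 := ℝ) T).isBounded.subset_closedBall 0
    exact ⟨R, by simpa [Real.closedBall_eq_Icc] using hR⟩
  have hb₁ : ∀ᵐ x ∂μ₁, x ∈ Icc (-R) R :=
    measure_mono_null (fun x hx hxT => hx (hR hxT)) hμ₁.null
  have hb₂ : ∀ᵐ x ∂μ₂, x ∈ Icc (-R) R :=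
    measure_mono_null (fun x hx hxT => hx (hR hxT)) hμ₂.null
  have hb : ∀ᵐ x ∂(μ₁ + μ₂), x ∈ Icc (-R) R := by
    rw [ae_add_measure_iff]
    exact ⟨hb₁, hb₂⟩
  have hst : (μ₁ + μ₂) {x | s x = 0 ∧ t x = 0} = 0 := by
    rw [Measure.add_apply, measure_mono_null (fun x hx => hx.1)
        (measure_eq_zero_of_density_eq_zero hsμ hs),
      measure_mono_null (fun x hx => hx.2) (measure_eq_zero_of_density_eq_zero htμ ht), add_zero]
  have m₁ := memLp_weight_mul_polynomial hs hsμ hb₁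
  have m₂ := memLp_weight_mul_polynomial ht htμ hb₂
  have horth : Orthonormal ℂ (Sum.elim (fun n => pairFirst t m₁ (jacobiPolynomial V₁ n))
      (fun n => pairSecond hs m₂ (jacobiPolynomial V₂ n))) := by
    refine orthonormal_sumElim ?_ ?_ fun i j => inner_pairFirst_pairSecond hs m₁ m₂ _ _
    · rw [orthonormal_iff_ite]
      intro i j
      rw [inner_pairFirst_pairFirst, ← integral_eq_integral_sq_mul hs hsμ, h₁.integral_mul hT hμ₁]
      split_ifs <;> simp
    · rw [orthonormal_iff_ite]
      intro i j
      rw [inner_pairSecond_pairSecond hs m₂ ht, ← integral_eq_integral_sq_mul ht htμ,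
        h₂.integral_mul hT hμ₂]
      split_ifs <;> simp
  -- Orthogonality to the `p n` alone gives orthogonality to the image of every polynomial, since
  -- the `p n` span.
  have extend : ∀ (V : ℕ → ℝ) (Φ : ℝ[X] → PairSpace (μ₁ + μ₂) s t)
      (_ : ∀ (P Q : ℝ[X]) (c : ℝ), Φ (P + C c * Q) = Φ P + (c : ℂ) • Φ Q)
      (F : PairSpace (μ₁ + μ₂) s t), (∀ n, ⟪Φ (jacobiPolynomial V n), F⟫_ℂ = 0) →
      ∀ P, ⟪Φ P, F⟫_ℂ = 0 := by
    intro V Φ hΦ F hF P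
    have hP : P ∈ Submodule.span ℝ (range (jacobiPolynomial V)) := by
      rw [span_jacobiPolynomial]; trivial
    have h0 : Φ 0 = 0 := by
      have := hΦ 0 0 1
      simpa using this
    induction hP using Submodule.span_induction with
    | zero => rw [h0, inner_zero_left]
    | add P Q _ _ hP hQ =>
      have := hΦ P Q 1
      rw [C_1, one_mul, Complex.ofReal_one, one_smul] at this
      rw [this, inner_add_left, hP, hQ, add_zero]
    | smul c P _ hP =>
      have := hΦ 0 P c
      rw [h0, zero_add, zero_add, ← smul_eq_C_mul] at this
      rw [this, inner_smul_left, hP, mul_zero]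
    | mem P hP =>
      obtain ⟨n, rfl⟩ := hP
      exact hF n
  have hspan := orthogonal_span_sumElim_eq_bot
    (v := fun n => pairFirst t m₁ (jacobiPolynomial V₁ n))
    (w := fun n => pairSecond hs m₂ (jacobiPolynomial V₂ n)) fun F hF₁ hF₂ =>
      pairSpace_eq_zero hs m₁ m₂ ht hb hst
        (extend V₁ _ (pairFirst_add_C_mul m₁) F hF₁)
        (extend V₂ _ (pairSecond_add_C_mul hs m₂) F hF₂)
  have horthH := orthonormal_sumElim h₁.orthonormal h₂.orthonormal hcross
  have hspanH := orthogonal_span_sumElim_eq_bot htotal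
  let bH := HilbertBasis.mkOfOrthogonalEqBot horthH hspanH
  let bK := HilbertBasis.mkOfOrthogonalEqBot horth hspan
  let U : H ≃ₗᵢ[ℂ] PairSpace (μ₁ + μ₂) s t := bH.repr.trans bK.repr.symm
  have hUb : ∀ i, U (bH i) = bK i := by
    intro i
    classical
    show bK.repr.symm (bH.repr (bH i)) = bK i
    rw [bH.repr_self, bK.repr_symm_single]
  have hU₁ : ∀ n, U (e₁ n) = pairFirst t m₁ (jacobiPolynomial V₁ n) := by
    intro n
    have := hUb (Sum.inl n)
    rwa [HilbertBasis.coe_mkOfOrthogonalEqBot, HilbertBasis.coe_mkOfOrthogonalEqBot] at this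
  have hU₂ : ∀ n, U (e₂ n) = pairSecond hs m₂ (jacobiPolynomial V₂ n) := by
    intro n
    have := hUb (Sum.inr n)
    rwa [HilbertBasis.coe_mkOfOrthogonalEqBot, HilbertBasis.coe_mkOfOrthogonalEqBot] at this
  refine ⟨inferInstance, measurableSet_setOf_lt_pairMultiplicity hs ht,
    Filter.Eventually.of_forall fun x => ?_, U, fun f n => ?_⟩
  · rw [pairMultiplicity]
    split_ifs
    · norm_num
    · exact le_rfl
  · obtain ⟨M, hM⟩ := exists_mul_operator (ae_restrict_of_ae
      (s := {x | (n : ℕ∞) < pairMultiplicity s t x}) hb)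
    let L : PairSpace (μ₁ + μ₂) s t →L[ℂ]
        Lp ℂ 2 ((μ₁ + μ₂).restrict {x | (n : ℕ∞) < pairMultiplicity s t x}) :=
      LinearMap.mkContinuous
        { toFun := fun F => F n, map_add' := fun _ _ => rfl, map_smul' := fun _ _ => rfl } 1
        (fun F => by rw [one_mul]; exact lp.norm_apply_le_norm two_ne_zero F n)
    let U' : H →L[ℂ] PairSpace (μ₁ + μ₂) s t := (U.toContinuousLinearEquiv : H →L[ℂ] _)
    -- Both sides are continuous, so the intertwining need only be checked on the basis, one
    -- component at a time.
    have key : L ∘L U' ∘L T = M ∘L L ∘L U' := by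
      refine ContinuousLinearMap.ext_on (s := range (Sum.elim e₁ e₂)) ?_ ?_
      · rwa [Submodule.dense_iff_topologicalClosure_eq_top,
          Submodule.topologicalClosure_eq_top_iff]
      · rintro _ ⟨i | i, rfl⟩
        · show U (T (e₁ i)) n = M (U (e₁ i) n)
          rw [h₁.map_apply U (pairFirst_add_C_mul m₁) hU₁, hU₁]
          exact Lp.ext ((pairFirst_X_mul m₁ _ n).trans (hM _).symm)
        · show U (T (e₂ i)) n = M (U (e₂ i) n)
          rw [h₂.map_apply U (pairSecond_add_C_mul hs m₂) hU₂, hU₂]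
          exact Lp.ext ((pairSecond_X_mul hs m₂ _ n).trans (hM _).symm)
    have hf : U (T f) n = M (U f n) := congr_arg (fun A => A f) key
    rw [hf]
    exact hM _

end HahnHellingerChains

/-! ### Discriminants of the hexagon and octagon ladders -/

section PeriodicLadders

open Polynomial
open scoped InnerProductSpace

/-- This is the recursion of the `S k` with `X` replaced by `d`. The hypothesis `h1` matches `S 1 =
X`. -/
theorem eq_mul_chebyshevS_comp {f : ℕ → ℝ[X]} {d : ℝ[X]} (h1 : f 1 = d * f 0)
    (h2 : ∀ k, f (k + 2) = d * f (k + 1) - f k) (k : ℕ) :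
    f k = f 0 * (Chebyshev.S ℝ k).comp d := by
  induction k using Nat.twoStepInduction with
  | zero => simp
  | one => rw [h1, Nat.cast_one, Chebyshev.S_one, X_comp, mul_comm]
  | more k ih1 ih2 =>
    have h3 : (Chebyshev.S ℝ ((k + 2 : ℕ) : ℤ))
        = X * Chebyshev.S ℝ ((k + 1 : ℕ) : ℤ) - Chebyshev.S ℝ (k : ℤ) := by
      push_cast
      exact Chebyshev.S_add_two ℝ k
    rw [h2, h3, sub_comp, mul_comp, X_comp, ih2, mul_sub, ih1]
    ring

/-- The rungs of the infinite linear hexagon. -/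
abbrev hexagonRungs : Set ℕ := range fun j : ℕ => 2 * j + 1

/-- The rungs of the infinite linear octagon. -/
abbrev octagonRungs : Set ℕ := range fun j : ℕ => 3 * j + 1

theorem hexagonPotential_eq (ε : ℝ) (n : ℕ) :
    ladderPotential hexagonRungs ε n = if n % 2 = 0 then ε else 0 := by
  rw [ladderPotential]
  by_cases h : n % 2 = 0
  · rw [if_pos h, if_pos ⟨n / 2, by dsimp only; omega⟩]
  · rw [if_neg h, if_neg]
    rintro ⟨j, hj⟩
    dsimp only at hj
    omega

theorem octagonPotential_eq (ε : ℝ) (n : ℕ) :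
    ladderPotential octagonRungs ε n = if n % 3 = 0 then ε else 0 := by
  rw [ladderPotential]
  by_cases h : n % 3 = 0
  · rw [if_pos h, if_pos ⟨n / 3, by dsimp only; omega⟩]
  · rw [if_neg h, if_neg]
    rintro ⟨j, hj⟩
    dsimp only at hj
    omega

/-- The discriminant of the Jacobi matrix with diagonal `ε, 0, ε, 0, …`. -/
noncomputable def hexagonDiscriminant (ε : ℝ) : ℝ[X] := X ^ 2 - C ε * X - C 2

/-- The discriminant of the Jacobi matrix with diagonal `ε, 0, 0, ε, 0, 0, …`. -/
noncomputable def octagonDiscriminant (ε : ℝ) : ℝ[X] := X ^ 3 - C ε * X ^ 2 - C 3 * X + C ε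

theorem eval_hexagonDiscriminant (ε x : ℝ) :
    (hexagonDiscriminant ε).eval x = x ^ 2 - ε * x - 2 := by
  simp [hexagonDiscriminant]

theorem eval_octagonDiscriminant (ε x : ℝ) :
    (octagonDiscriminant ε).eval x = x ^ 3 - ε * x ^ 2 - 3 * x + ε := by
  simp [octagonDiscriminant]

theorem derivative_hexagonDiscriminant_ne_zero (ε : ℝ) :
    (hexagonDiscriminant ε).derivative ≠ 0 := by
  intro h
  have h1 := congr_arg (eval 0) h
  have h2 := congr_arg (eval 1) h
  simp [hexagonDiscriminant] at h1 h2
  norm_num [h1] at h2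

theorem derivative_octagonDiscriminant_ne_zero (ε : ℝ) :
    (octagonDiscriminant ε).derivative ≠ 0 := by
  intro h
  have h1 := congr_arg (eval 0) h
  simp [octagonDiscriminant] at h1

theorem hexagon_jacobiPolynomial_one (ε : ℝ) :
    jacobiPolynomial (ladderPotential hexagonRungs ε) 1 = X - C ε := by
  rw [jacobiPolynomial_one, hexagonPotential_eq, if_pos rfl]

theorem octagon_jacobiPolynomial_one (ε : ℝ) :
    jacobiPolynomial (ladderPotential octagonRungs ε) 1 = X - C ε := by
  rw [jacobiPolynomial_one, octagonPotential_eq, if_pos rfl]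

theorem octagon_jacobiPolynomial_two (ε : ℝ) :
    jacobiPolynomial (ladderPotential octagonRungs ε) 2 = X ^ 2 - C ε * X - 1 := by
  rw [jacobiPolynomial_add_two, zero_add, octagon_jacobiPolynomial_one, jacobiPolynomial_zero,
    octagonPotential_eq]
  simp
  ring

theorem hexagon_jacobiPolynomial_eq (ε : ℝ) (k : ℕ) :
    jacobiPolynomial (ladderPotential hexagonRungs ε) ((1 + 1) * k + 1)
      = jacobiPolynomial (ladderPotential hexagonRungs ε) 1 *
        (Chebyshev.S ℝ k).comp (hexagonDiscriminant ε) := by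
  have hV : ∀ n, ladderPotential hexagonRungs ε n = if n % 2 = 0 then ε else 0 :=
    hexagonPotential_eq ε
  generalize ladderPotential hexagonRungs ε = V at hV ⊢
  refine eq_mul_chebyshevS_comp (f := fun k => jacobiPolynomial V ((1 + 1) * k + 1)) ?_
    (fun k => ?_) k
  · have h3 := jacobiPolynomial_add_two V 1
    have h2 := jacobiPolynomial_add_two V 0
    have h1 := jacobiPolynomial_one V
    have h0 := jacobiPolynomial_zero V
    simp only [hV, Nat.reduceAdd, Nat.reduceMod, if_true, one_ne_zero, if_false, map_zero,
      sub_zero] at h3 h2 h1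
    show jacobiPolynomial V 3 = _ * jacobiPolynomial V 1
    rw [h3, h2, h1, h0, hexagonDiscriminant, show (C 2 : ℝ[X]) = 2 from rfl]
    ring
  · have h5 := jacobiPolynomial_add_two V (2 * k + 3)
    have h4 := jacobiPolynomial_add_two V (2 * k + 2)
    have h3 := jacobiPolynomial_add_two V (2 * k + 1)
    rw [hV, if_pos (by omega)] at h5 h3
    rw [hV, if_neg (by omega), map_zero, sub_zero] at h4
    show jacobiPolynomial V (2 * k + 5) = _ * jacobiPolynomial V (2 * k + 3)
      - jacobiPolynomial V (2 * k + 1)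
    rw [hexagonDiscriminant, show (C 2 : ℝ[X]) = 2 from rfl]
    -- The multipliers eliminate the polynomials of even index.
    linear_combination h5 + (X - C ε) * h4 + h3

theorem octagon_jacobiPolynomial_eq (ε : ℝ) (k : ℕ) :
    jacobiPolynomial (ladderPotential octagonRungs ε) ((2 + 1) * k + 2)
      = jacobiPolynomial (ladderPotential octagonRungs ε) 2 *
        (Chebyshev.S ℝ k).comp (octagonDiscriminant ε) := by
  have hV : ∀ n, ladderPotential octagonRungs ε n = if n % 3 = 0 then ε else 0 :=
    octagonPotential_eq ε
  generalize ladderPotential octagonRungs ε = V at hV ⊢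
  refine eq_mul_chebyshevS_comp (f := fun k => jacobiPolynomial V ((2 + 1) * k + 2)) ?_
    (fun k => ?_) k
  · have h5 := jacobiPolynomial_add_two V 3
    have h4 := jacobiPolynomial_add_two V 2
    have h3 := jacobiPolynomial_add_two V 1
    have h2 := jacobiPolynomial_add_two V 0
    have h1 := jacobiPolynomial_one V
    have h0 := jacobiPolynomial_zero V
    simp only [hV, Nat.reduceAdd, Nat.reduceMod, if_true, one_ne_zero, OfNat.ofNat_ne_zero,
      if_false, map_zero, sub_zero] at h5 h4 h3 h2 h1
    show jacobiPolynomial V 5 = _ * jacobiPolynomial V 2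
    rw [h5, h4, h3, h2, h1, h0, octagonDiscriminant, show (C 3 : ℝ[X]) = 3 from rfl]
    ring
  · have h8 := jacobiPolynomial_add_two V (3 * k + 6)
    have h7 := jacobiPolynomial_add_two V (3 * k + 5)
    have h6 := jacobiPolynomial_add_two V (3 * k + 4)
    have h5 := jacobiPolynomial_add_two V (3 * k + 3)
    have h4 := jacobiPolynomial_add_two V (3 * k + 2)
    rw [hV, if_pos (by omega)] at h7 h4
    rw [hV, if_neg (by omega), map_zero, sub_zero] at h8 h6 h5
    show jacobiPolynomial V (3 * k + 8) = _ * jacobiPolynomial V (3 * k + 5)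
      - jacobiPolynomial V (3 * k + 2)
    rw [octagonDiscriminant, show (C 3 : ℝ[X]) = 3 from rfl]
    -- The multipliers eliminate the polynomials whose index is not `2` modulo `3`.
    linear_combination h8 + X * h7 + (X * (X - C ε) - 1) * h6 + (X - C ε) * h5 + h4

/-- The divided difference of the discriminant is `(x - ε) + y`, so the coefficient of `p 0` is `y`.
-/
theorem isPeriodicSpectralMeasure_hexagon {ε : ℝ} (hε : ε ^ 2 = 1) {μ : Measure ℝ}
    (hμ : IsSpectralMeasure μ (simonLadderOperator hexagonRungs) (ladderVector ε 0)) :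
    IsPeriodicSpectralMeasure μ (X - C ε) (hexagonDiscriminant ε)
      (fun j : Fin 1 => jacobiPolynomial (ladderPotential hexagonRungs ε) j) ![X] := by
  rw [← hexagon_jacobiPolynomial_one]
  refine (isJacobiChain_ladder _ hε).isPeriodicSpectralMeasure
    (isSelfAdjoint_simonLadderOperator _) hμ (hexagon_jacobiPolynomial_eq ε) fun x y => ?_
  rw [hexagon_jacobiPolynomial_one]
  simp [eval_hexagonDiscriminant, jacobiPolynomial_zero]
  ring

/-- The divided difference of the discriminant is `(x² - εx - 1) + (y² - 2) + y (x - ε)`, which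
gives the coefficients of `p 0` and `p 1`. -/
theorem isPeriodicSpectralMeasure_octagon {ε : ℝ} (hε : ε ^ 2 = 1) {μ : Measure ℝ}
    (hμ : IsSpectralMeasure μ (simonLadderOperator octagonRungs) (ladderVector ε 0)) :
    IsPeriodicSpectralMeasure μ (X ^ 2 - C ε * X - 1) (octagonDiscriminant ε)
      (fun j : Fin 2 => jacobiPolynomial (ladderPotential octagonRungs ε) j)
      ![X ^ 2 - C 2, X] := by
  rw [← octagon_jacobiPolynomial_two]
  refine (isJacobiChain_ladder _ hε).isPeriodicSpectralMeasure
    (isSelfAdjoint_simonLadderOperator _) hμ (octagon_jacobiPolynomial_eq ε) fun x y => ?_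
  rw [octagon_jacobiPolynomial_two]
  simp [eval_octagonDiscriminant, jacobiPolynomial_zero, octagon_jacobiPolynomial_one]
  ring

theorem simonLadder_spectrum_subset {Λ : Set ℕ} {μ ν : Measure ℝ}
    (hμ : IsSpectralMeasure μ (simonLadderOperator Λ) (ladderVector 1 0))
    (hν : IsSpectralMeasure ν (simonLadderOperator Λ) (ladderVector (-1) 0))
    {K : Set ℝ} (hK : IsClosed K) (hne : K.Nonempty) (hμK : ∀ᵐ x ∂μ, x ∈ K)
    (hνK : ∀ᵐ x ∂ν, x ∈ K) : spectrum ℝ (simonLadderOperator Λ) ⊆ K := by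
  refine spectrum_subset_of_cfc_apply_eq_zero (isSelfAdjoint_simonLadderOperator Λ)
    ladderVector_total hK hne ?_
  rintro f hf hfK _ (⟨n, rfl⟩ | ⟨n, rfl⟩)
  · exact (isJacobiChain_ladder Λ (by norm_num)).cfc_apply_eq_zero
      (isSelfAdjoint_simonLadderOperator Λ) hμ hf (hμK.mono hfK) n
  · exact (isJacobiChain_ladder Λ (by norm_num)).cfc_apply_eq_zero
      (isSelfAdjoint_simonLadderOperator Λ) hν hf (hνK.mono hfK) n

theorem simonLadder_spectrum_complex (Λ : Set ℕ) : spectrum ℂ (simonLadderOperator Λ)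
    = (fun x : ℝ => (x : ℂ)) '' spectrum ℝ (simonLadderOperator Λ) :=
  ((isSelfAdjoint_simonLadderOperator Λ).spectrumRestricts.algebraMap_image).symm

theorem exists_isSpectralMeasure_ladderVector (Λ : Set ℕ) (ε : ℝ) :
    ∃ μ, IsSpectralMeasure μ (simonLadderOperator Λ) (ladderVector ε 0) := by
  obtain ⟨μ, h1, h2, h3⟩ :=
    exists_spectralMeasure (isSelfAdjoint_simonLadderOperator Λ) (ladderVector ε 0)
  exact ⟨μ, h1, h2, h3⟩

end PeriodicLadders

/-! ### The spectra as unions of bands -/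

section Spectra

open Polynomial
open scoped InnerProductSpace

/-- The bands are given by `0 ≤ x (x - ε) ≤ 4`. The gap `(0, 1)` of `ε = 1` is covered by `ε = -1`,
and the gap `(-1, 0)` of `ε = -1` by `ε = 1`. -/
theorem hexagon_spectrum_real : spectrum ℝ (simonLadderOperator hexagonRungs)
    = Icc ((-1 - √17) / 2) ((1 + √17) / 2) := by
  obtain ⟨μ, hμ⟩ := exists_isSpectralMeasure_ladderVector hexagonRungs 1
  obtain ⟨ν, hν⟩ := exists_isSpectralMeasure_ladderVector hexagonRungs (-1)
  have pμ := isPeriodicSpectralMeasure_hexagon (by norm_num) hμ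
  have pν := isPeriodicSpectralMeasure_hexagon (by norm_num) hν
  have := hμ.isFiniteMeasure
  have := hν.isFiniteMeasure
  have hw : √17 ^ 2 = 17 := Real.sq_sqrt (by norm_num)
  have hw4 : 4 < √17 := by rw [Real.lt_sqrt (by norm_num)]; norm_num
  have hw5 : √17 < 5 := by rw [Real.sqrt_lt' (by norm_num)]; norm_num
  generalize √17 = w at hw hw4 hw5
  refine Subset.antisymm (simonLadder_spectrum_subset hμ hν isClosed_Icc
    ⟨0, by constructor <;> linarith⟩ ?_ ?_) ?_
  · filter_upwards [pμ.ae_discriminant_mem] with x hx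
    simp only [eval_sub, eval_X, eval_C, eval_hexagonDiscriminant, mem_Icc] at hx
    rcases hx with hx | ⟨-, hx⟩
    · constructor <;> linarith
    · constructor <;> nlinarith
  · filter_upwards [pν.ae_discriminant_mem] with x hx
    simp only [eval_sub, eval_X, eval_C, eval_hexagonDiscriminant, mem_Icc] at hx
    rcases hx with hx | ⟨-, hx⟩
    · constructor <;> linarith
    · constructor <;> nlinarith
  · have b₁ : Icc ((1 - w) / 2) 0 ⊆ spectrum ℝ (simonLadderOperator hexagonRungs) := by
      refine pμ.Icc_subset_spectrum hμ (derivative_hexagonDiscriminant_ne_zero 1) (by linarith)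
        (fun x hx y hy h => ?_) fun x hx => ?_
      · simp only [eval_hexagonDiscriminant] at h
        have : (x - y) * (x + y - 1) = 0 := by linear_combination h
        rcases mul_eq_zero.1 this with h | h <;> linarith [hx.2, hy.2]
      · rw [eval_hexagonDiscriminant]
        constructor <;> nlinarith [hx.1, hx.2]
    have b₂ : Icc 1 ((1 + w) / 2) ⊆ spectrum ℝ (simonLadderOperator hexagonRungs) := by
      refine pμ.Icc_subset_spectrum hμ (derivative_hexagonDiscriminant_ne_zero 1) (by linarith)
        (fun x hx y hy h => ?_) fun x hx => ?_
      · simp only [eval_hexagonDiscriminant] at h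
        have : (x - y) * (x + y - 1) = 0 := by linear_combination h
        rcases mul_eq_zero.1 this with h | h <;> linarith [hx.1, hy.1]
      · rw [eval_hexagonDiscriminant]
        constructor <;> nlinarith [hx.1, hx.2]
    have b₃ : Icc 0 ((w - 1) / 2) ⊆ spectrum ℝ (simonLadderOperator hexagonRungs) := by
      refine pν.Icc_subset_spectrum hν (derivative_hexagonDiscriminant_ne_zero (-1)) (by linarith)
        (fun x hx y hy h => ?_) fun x hx => ?_
      · simp only [eval_hexagonDiscriminant] at h
        have : (x - y) * (x + y + 1) = 0 := by linear_combination h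
        rcases mul_eq_zero.1 this with h | h <;> linarith [hx.1, hy.1]
      · rw [eval_hexagonDiscriminant]
        constructor <;> nlinarith [hx.1, hx.2]
    have b₄ : Icc ((-1 - w) / 2) (-1) ⊆ spectrum ℝ (simonLadderOperator hexagonRungs) := by
      refine pν.Icc_subset_spectrum hν (derivative_hexagonDiscriminant_ne_zero (-1)) (by linarith)
        (fun x hx y hy h => ?_) fun x hx => ?_
      · simp only [eval_hexagonDiscriminant] at h
        have : (x - y) * (x + y + 1) = 0 := by linear_combination h
        rcases mul_eq_zero.1 this with h | h <;> linarith [hx.2, hy.2]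
      · rw [eval_hexagonDiscriminant]
        constructor <;> nlinarith [hx.1, hx.2]
    intro x hx
    rcases le_total x (-1) with h1 | h1
    · exact b₄ ⟨hx.1, h1⟩
    rcases le_total x 0 with h2 | h2
    · exact b₁ ⟨by linarith, h2⟩
    rcases le_total x 1 with h3 | h3
    · exact b₃ ⟨h2, by linarith⟩
    · exact b₂ ⟨h3, hx.2⟩

theorem octagon_band_subset_spectrum {ε : ℝ} (hε : ε ^ 2 = 1) {α β : ℝ} (hαβ : α < β)
    (hne : ∀ x ∈ Icc α β, ∀ y ∈ Icc α β, x ^ 2 + x * y + y ^ 2 - ε * (x + y) - 3 ≠ 0)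
    (hmem : ∀ x ∈ Icc α β, x ^ 3 - ε * x ^ 2 - 3 * x + ε ∈ Icc (-2 : ℝ) 2) :
    Icc α β ⊆ spectrum ℝ (simonLadderOperator octagonRungs) := by
  obtain ⟨μ, hμ⟩ := exists_isSpectralMeasure_ladderVector octagonRungs ε
  refine (isPeriodicSpectralMeasure_octagon hε hμ).Icc_subset_spectrum hμ
    (derivative_octagonDiscriminant_ne_zero ε) hαβ (fun x hx y hy h => ?_) fun x hx => ?_
  · simp only [eval_octagonDiscriminant] at h
    have : (x - y) * (x ^ 2 + x * y + y ^ 2 - ε * (x + y) - 3) = 0 := by linear_combination h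
    exact sub_eq_zero.1 ((mul_eq_zero.1 this).resolve_right (hne x hx y hy))
  · rw [eval_octagonDiscriminant]
    exact hmem x hx

/-- For `ε = 1` the band edges come from `d + 2 = (x - 1)(x² - 3)` and `d - 2 = (x + 1)(x² - 2x -
1)`. The same factorisations give the other two bands. -/
theorem octagon_lower_band {x : ℝ} (hx : x ∈ Icc (-√3) (-1)) :
    x ^ 3 - x ^ 2 - 3 * x + 1 ∈ Icc (-2 : ℝ) 2 := by
  have h3 : √3 ^ 2 = 3 := Real.sq_sqrt (by norm_num)
  have h3' : (0 : ℝ) < √3 := by positivity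
  have hx2 : x ^ 2 ≤ 3 := by nlinarith [hx.1, hx.2]
  have hx1 := hx.2
  constructor
  · nlinarith [mul_nonneg (sub_nonneg.2 hx2) (by linarith : (0 : ℝ) ≤ 1 - x)]
  · nlinarith [mul_nonneg (by nlinarith : (0 : ℝ) ≤ x ^ 2 - 2 * x - 1)
      (by linarith : (0 : ℝ) ≤ -1 - x)]

theorem octagon_middle_band {x : ℝ} (hx : x ∈ Icc (1 - √2) 1) :
    x ^ 3 - x ^ 2 - 3 * x + 1 ∈ Icc (-2 : ℝ) 2 := by
  have h2 : √2 ^ 2 = 2 := Real.sq_sqrt (by norm_num)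
  have h2' : (0 : ℝ) < √2 := by positivity
  have h2'' : √2 < 2 := by rw [Real.sqrt_lt' (by norm_num)]; norm_num
  have hx1 := hx.1
  have hx2 := hx.2
  have hx3 : x ^ 2 - 2 * x - 1 ≤ 0 := by nlinarith
  have hx4 : x ^ 2 ≤ 3 := by nlinarith
  constructor
  · nlinarith [mul_nonneg (sub_nonneg.2 hx4) (by linarith : (0 : ℝ) ≤ 1 - x)]
  · nlinarith [mul_nonneg (neg_nonneg.2 hx3) (by linarith : (0 : ℝ) ≤ x + 1)]

theorem octagon_upper_band {x : ℝ} (hx : x ∈ Icc √3 (1 + √2)) :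
    x ^ 3 - x ^ 2 - 3 * x + 1 ∈ Icc (-2 : ℝ) 2 := by
  have h2 : √2 ^ 2 = 2 := Real.sq_sqrt (by norm_num)
  have h2' : (0 : ℝ) < √2 := by positivity
  have h3 : √3 ^ 2 = 3 := Real.sq_sqrt (by norm_num)
  have h3' : 1 < √3 := by rw [Real.lt_sqrt (by norm_num)]; norm_num
  have hx1 := hx.1
  have hx2 := hx.2
  have hx3 : x ^ 2 - 2 * x - 1 ≤ 0 := by nlinarith
  have hx4 : 3 ≤ x ^ 2 := by nlinarith
  constructor
  · nlinarith [mul_nonneg (sub_nonneg.2 hx4) (by linarith : (0 : ℝ) ≤ x - 1)]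
  · nlinarith [mul_nonneg (neg_nonneg.2 hx3) (by linarith : (0 : ℝ) ≤ x + 1)]

/-- The expression is the divided difference of the discriminant for `ε = 1`; its sign makes the
discriminant injective on the middle band. -/
theorem octagon_middle_band_difference_neg {x y : ℝ} (hx : x ∈ Icc (1 - √2) 1)
    (hy : y ∈ Icc (1 - √2) 1) : x ^ 2 + x * y + y ^ 2 - (x + y) - 3 < 0 := by
  have h2'' : √2 < 3 / 2 := by rw [Real.sqrt_lt' (by norm_num)]; norm_num
  have hx1 : -(1 / 2) < x := by linarith [hx.1]
  have hy1 : -(1 / 2) < y := by linarith [hy.1]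
  have hx2 := hx.2
  have hy2 := hy.2
  nlinarith [mul_nonneg (sub_nonneg.2 hx2) (sub_nonneg.2 hx1.le),
    mul_nonneg (sub_nonneg.2 hy2) (sub_nonneg.2 hy1.le),
    mul_nonneg (sub_nonneg.2 hx2) (sub_nonneg.2 hy2)]

/-- The discriminant for `ε = -1` is `-d(-x)`, with `d` that for `ε = 1`, so its bands are the
reflected ones. The three bands and their reflections cover the interval. -/
theorem octagon_spectrum_real : spectrum ℝ (simonLadderOperator octagonRungs)
    = Icc (-1 - √2) (1 + √2) := by
  obtain ⟨μ, hμ⟩ := exists_isSpectralMeasure_ladderVector octagonRungs 1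
  obtain ⟨ν, hν⟩ := exists_isSpectralMeasure_ladderVector octagonRungs (-1)
  have pμ := isPeriodicSpectralMeasure_octagon (by norm_num) hμ
  have pν := isPeriodicSpectralMeasure_octagon (by norm_num) hν
  have := hμ.isFiniteMeasure
  have := hν.isFiniteMeasure
  have h2 : √2 ^ 2 = 2 := Real.sq_sqrt (by norm_num)
  have h2' : 1 < √2 := by rw [Real.lt_sqrt (by norm_num)]; norm_num
  have h2'' : √2 < 3 / 2 := by rw [Real.sqrt_lt' (by norm_num)]; norm_num
  have h3 : √3 ^ 2 = 3 := Real.sq_sqrt (by norm_num)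
  have h3' : 3 / 2 < √3 := by rw [Real.lt_sqrt (by norm_num)]; norm_num
  have h3'' : √3 < 2 := by rw [Real.sqrt_lt' (by norm_num)]; norm_num
  have aux : ∀ x : ℝ, x ^ 2 - x - 1 = 0 ∨ x ^ 3 - x ^ 2 - 3 * x + 1 ∈ Icc (-2 : ℝ) 2 →
      x ∈ Icc (-1 - √2) (1 + √2) := by
    rintro x (hx | ⟨hx1, hx2⟩)
    · constructor <;> nlinarith
    · constructor
      · by_contra! hlt
        nlinarith [mul_pos (by nlinarith : 0 < x ^ 2 - 3) (by linarith : 0 < 1 - x)]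
      · by_contra! hlt
        nlinarith [mul_pos (by nlinarith : 0 < x ^ 2 - 2 * x - 1) (by linarith : 0 < x + 1)]
  refine Subset.antisymm (simonLadder_spectrum_subset hμ hν isClosed_Icc
    ⟨0, by constructor <;> linarith⟩ ?_ ?_) ?_
  · filter_upwards [pμ.ae_discriminant_mem] with x hx
    simp only [eval_sub, eval_pow, eval_mul, eval_X, eval_C, eval_one, one_mul,
      eval_octagonDiscriminant] at hx
    exact aux x hx
  · filter_upwards [pν.ae_discriminant_mem] with x hx
    simp only [eval_sub, eval_pow, eval_mul, eval_X, eval_C, eval_one,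
      eval_octagonDiscriminant, mem_Icc] at hx
    have := aux (-x) (hx.imp (fun h => by linarith)
      fun h => ⟨by linarith [h.2], by linarith [h.1]⟩)
    exact ⟨by linarith [this.2], by linarith [this.1]⟩
  · have pos : ∀ {α β : ℝ}, α < β →
        (∀ x ∈ Icc α β, ∀ y ∈ Icc α β, x ^ 2 + x * y + y ^ 2 - (x + y) - 3 ≠ 0) →
        (∀ x ∈ Icc α β, x ^ 3 - x ^ 2 - 3 * x + 1 ∈ Icc (-2 : ℝ) 2) →
        ∀ x, x ∈ Icc α β ∨ -x ∈ Icc α β →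
          x ∈ spectrum ℝ (simonLadderOperator octagonRungs) := by
      rintro α β hαβ hne hmem x (hx | hx)
      · exact octagon_band_subset_spectrum (ε := 1) (by norm_num) hαβ
          (fun x hx y hy => by rw [one_mul]; exact hne x hx y hy)
          (fun x hx => by rw [one_mul]; exact hmem x hx) hx
      · refine octagon_band_subset_spectrum (ε := -1) (α := -β) (β := -α) (by norm_num)
          (by linarith) (fun x hx y hy h => ?_) (fun x hx => ?_)
          ⟨by linarith [hx.2], by linarith [hx.1]⟩
        · refine hne (-x) ⟨by linarith [hx.2], by linarith [hx.1]⟩ (-y)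
            ⟨by linarith [hy.2], by linarith [hy.1]⟩ ?_
          linear_combination h
        · have := hmem (-x) ⟨by linarith [hx.2], by linarith [hx.1]⟩
          exact ⟨by linarith [this.2], by linarith [this.1]⟩
    have b₁ := pos (α := -√3) (β := -1) (by linarith)
      (fun x hx y hy => by nlinarith [hx.2, hy.2]) fun x hx => octagon_lower_band hx
    have b₂ := pos (α := 1 - √2) (β := 1) (by linarith)
      (fun x hx y hy => (octagon_middle_band_difference_neg hx hy).ne)
      fun x hx => octagon_middle_band hx
    have b₃ := pos (α := √3) (β := 1 + √2) (by linarith)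
      (fun x hx y hy => by nlinarith [hx.1, hy.1]) fun x hx => octagon_upper_band hx
    intro x hx
    rcases le_total x (-√3) with c1 | c1
    · exact b₃ x (Or.inr ⟨by linarith, by linarith [hx.1]⟩)
    rcases le_total x (-1) with c2 | c2
    · exact b₁ x (Or.inl ⟨c1, c2⟩)
    rcases le_total x 0 with c3 | c3
    · exact b₂ x (Or.inr ⟨by linarith, by linarith⟩)
    rcases le_total x 1 with c4 | c4
    · exact b₂ x (Or.inl ⟨by linarith, c4⟩)
    rcases le_total x √3 with c5 | c5
    · exact b₁ x (Or.inr ⟨by linarith, by linarith⟩)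
    · exact b₃ x (Or.inl ⟨c5, hx.2⟩)

end Spectra

/-! ### Spectral multiplicity of the octagon -/

section Multiplicity

open Polynomial
open scoped InnerProductSpace

/-- With `u = x³ - 3x` and `v = x² - 1` the hypotheses say `|u| ≤ 2 - |v|`. Squaring gives `(x² -
1)(x² - 3)² ≤ 0` and `(x² - 1)(x⁴ - 6x² + 1) ≤ 0`. The first settles `x² ≥ 1`; in the second the
quartic has roots `x² = (√2 ± 1)²`, which settles `x² < 1`. -/
theorem mem_of_octagon_discriminants_mem {x : ℝ} (h₁ : x ^ 3 - x ^ 2 - 3 * x + 1 ∈ Icc (-2 : ℝ) 2)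
    (h₂ : x ^ 3 + x ^ 2 - 3 * x - 1 ∈ Icc (-2 : ℝ) 2) :
    x ∈ Icc (1 - √2) (√2 - 1) ∨ (x ^ 2 - 1) * (x ^ 2 - 3) = 0 := by
  have hu₁ : x ^ 3 - 3 * x ≤ 2 - (x ^ 2 - 1) := by linarith [h₂.2]
  have hu₂ : -(2 - (x ^ 2 - 1)) ≤ x ^ 3 - 3 * x := by linarith [h₁.1]
  have hu₃ : x ^ 3 - 3 * x ≤ 2 + (x ^ 2 - 1) := by linarith [h₁.2]
  have hu₄ : -(2 + (x ^ 2 - 1)) ≤ x ^ 3 - 3 * x := by linarith [h₂.1]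
  have k₁ : (x ^ 3 - 3 * x) ^ 2 ≤ (2 - (x ^ 2 - 1)) ^ 2 := sq_le_sq' hu₂ hu₁
  have k₂ : (x ^ 3 - 3 * x) ^ 2 ≤ (2 + (x ^ 2 - 1)) ^ 2 := sq_le_sq' hu₄ hu₃
  rcases lt_or_ge (x ^ 2) 1 with hx | hx
  · left
    have hm : (x ^ 2 - 1) * (x ^ 4 - 6 * x ^ 2 + 1) ≤ 0 := by nlinarith
    have hp : 0 ≤ x ^ 4 - 6 * x ^ 2 + 1 := by
      by_contra! h
      nlinarith [mul_pos_of_neg_of_neg (by linarith : x ^ 2 - 1 < 0) h]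
    have h2 : √2 ^ 2 = 2 := Real.sq_sqrt (by norm_num)
    have h2' : 1 < √2 := by rw [Real.lt_sqrt (by norm_num)]; norm_num
    have hle : x ^ 2 ≤ (√2 - 1) ^ 2 := by
      by_contra! h
      have e : x ^ 4 - 6 * x ^ 2 + 1 = (x ^ 2 - (√2 - 1) ^ 2) * (x ^ 2 - (√2 + 1) ^ 2) := by
        linear_combination (2 * x ^ 2 - √2 ^ 2) * h2
      nlinarith [mul_pos (sub_pos.2 h) (by nlinarith : 0 < (√2 + 1) ^ 2 - x ^ 2)]
    have := abs_le_of_sq_le_sq' hle (by linarith)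
    exact ⟨by linarith [this.1], this.2⟩
  · right
    have h3 : x ^ 2 ≤ 3 := by linarith
    have hm : (x ^ 2 - 1) * (x ^ 2 - 3) ^ 2 ≤ 0 := by nlinarith
    have hm0 : (x ^ 2 - 1) * (x ^ 2 - 3) ^ 2 = 0 :=
      le_antisymm hm (mul_nonneg (by linarith) (sq_nonneg _))
    rcases mul_eq_zero.1 hm0 with h | h
    · rw [h, zero_mul]
    · rw [pow_eq_zero_iff two_ne_zero] at h
      rw [h, mul_zero]

theorem finite_zeros {P : ℝ[X]} (hP : P ≠ 0) : {x | P.eval x = 0}.Finite :=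
  (P.roots.toFinset.finite_toSet).subset fun x hx => by simpa [hP] using hx

theorem octagon_quadratic_neg {x : ℝ} (hx : x ∈ Icc (1 - √2) (√2 - 1)) {ε : ℝ} (hε : ε ^ 2 = 1) :
    x ^ 2 - ε * x - 1 < 0 := by
  have h2 : √2 < 3 / 2 := by rw [Real.sqrt_lt' (by norm_num)]; norm_num
  have h₁ : -(1 / 2) < x := by linarith [hx.1]
  have h₂ : x < 1 / 2 := by linarith [hx.2]
  rcases mul_self_eq_one_iff.1 ((sq ε).symm.trans hε) with rfl | rfl <;> nlinarith

/-- Multiplicity `2` requires both densities to be nonzero. On the inner interval each measure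
vanishes on the zero set of its own density, and Lebesgue measure transfers this to the other
measure. Off it, both densities can be nonzero only on a set that is null for the sum. -/
theorem octagon_multiplicity {k : ℕ∞} {S : Set ℝ}
    (hk : (k = 2 ∧ S = Icc (1 - √2) (√2 - 1)) ∨ (k = 1 ∧ S = (Icc (1 - √2) (√2 - 1))ᶜ)) :
    HasSpectralMultiplicityOn (simonLadderOperator octagonRungs) k S := by
  obtain ⟨μ, hμ⟩ := exists_isSpectralMeasure_ladderVector octagonRungs 1
  obtain ⟨ν, hν⟩ := exists_isSpectralMeasure_ladderVector octagonRungs (-1)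
  have pμ := isPeriodicSpectralMeasure_octagon (by norm_num) hμ
  have pν := isPeriodicSpectralMeasure_octagon (by norm_num) hν
  have := hμ.isFiniteMeasure
  have := hν.isFiniteMeasure
  obtain ⟨s, hs, hsμ⟩ := exists_sq_density (Measure.absolutelyContinuous_of_le
    (Measure.le_add_right (le_refl μ) : μ ≤ μ + ν))
  obtain ⟨t, ht, htν⟩ := exists_sq_density (Measure.absolutelyContinuous_of_le
    (Measure.le_add_left (le_refl ν) : ν ≤ μ + ν))
  refine ⟨μ + ν, pairMultiplicity s t, isHahnHellingerForm_of_isJacobiChain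
    (isSelfAdjoint_simonLadderOperator _) (isJacobiChain_ladder _ (by norm_num))
    (isJacobiChain_ladder _ (by norm_num))
    (fun m n => by rw [inner_ladderVector_ladderVector]; norm_num)
    (fun f => eq_zero_of_inner_ladderVector) hμ hν hs ht hsμ htν, ?_⟩
  set I := Icc (1 - √2) (√2 - 1) with hI
  have h2 : √2 < 3 / 2 := by rw [Real.sqrt_lt' (by norm_num)]; norm_num
  rcases hk with ⟨rfl, rfl⟩ | ⟨rfl, rfl⟩
  · have hs0 : MeasurableSet (I ∩ {x | s x = 0}) :=
      measurableSet_Icc.inter (hs (measurableSet_singleton 0))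
    have ht0 : MeasurableSet (I ∩ {x | t x = 0}) :=
      measurableSet_Icc.inter (ht (measurableSet_singleton 0))
    have hIb : ∀ x ∈ I, x ∈ Icc (-1 : ℝ) 1 := fun x hx =>
      ⟨by linarith [hx.1], by linarith [hx.2]⟩
    have hIm : ∀ x ∈ I, x ∈ Icc (1 - √2) 1 := fun x hx => ⟨hx.1, (hIb x hx).2⟩
    have hIn : ∀ x ∈ I, -x ∈ Icc (1 - √2) 1 := fun x hx =>
      ⟨by linarith [hx.2], by linarith [(hIb x hx).1]⟩
    have sμ : μ (I ∩ {x | s x = 0}) = 0 :=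
      measure_mono_null inter_subset_right (measure_eq_zero_of_density_eq_zero hsμ hs)
    have tν : ν (I ∩ {x | t x = 0}) = 0 :=
      measure_mono_null inter_subset_right (measure_eq_zero_of_density_eq_zero htν ht)
    -- From `μ`-null to Lebesgue null to `ν`-null. The interval lies in the middle band of each
    -- block and avoids the zeros of both quadratics.
    have sν : ν (I ∩ {x | s x = 0}) = 0 := by
      refine pν.measure_eq_zero_of_volume (pμ.volume_eq_zero_of_measure
        (derivative_octagonDiscriminant_ne_zero _) hs0 sμ (B := 1)
        (fun x hx => hIb x hx.1) (fun x hx y hy h => ?_) fun x hx => ?_) fun x hx => ?_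
      · simp only [eval_octagonDiscriminant] at h
        have e : (x - y) * (x ^ 2 + x * y + y ^ 2 - (x + y) - 3) = 0 := by linear_combination h
        exact sub_eq_zero.1 ((mul_eq_zero.1 e).resolve_right
          (octagon_middle_band_difference_neg (hIm x hx.1) (hIm y hy.1)).ne)
      · rw [eval_octagonDiscriminant, one_mul]
        exact octagon_middle_band (hIm x hx.1)
      · simpa using (octagon_quadratic_neg hx.1 (ε := -1) (by norm_num)).ne
    have tμ : μ (I ∩ {x | t x = 0}) = 0 := by
      refine pμ.measure_eq_zero_of_volume (pν.volume_eq_zero_of_measure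
        (derivative_octagonDiscriminant_ne_zero _) ht0 tν (B := 1)
        (fun x hx => hIb x hx.1) (fun x hx y hy h => ?_) fun x hx => ?_) fun x hx => ?_
      · simp only [eval_octagonDiscriminant] at h
        have e : (x - y) * ((-x) ^ 2 + (-x) * (-y) + (-y) ^ 2 - (-x + -y) - 3) = 0 := by
          linear_combination h
        exact sub_eq_zero.1 ((mul_eq_zero.1 e).resolve_right
          (octagon_middle_band_difference_neg (hIn x hx.1) (hIn y hy.1)).ne)
      · rw [eval_octagonDiscriminant]
        have := octagon_middle_band (hIn x hx.1)
        exact ⟨by linarith [this.2], by linarith [this.1]⟩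
      · simpa using (octagon_quadratic_neg hx.1 (ε := 1) (by norm_num)).ne
    refine measure_mono_null (t := (I ∩ {x | s x = 0}) ∪ (I ∩ {x | t x = 0})) ?_ ?_
    · intro x hx
      have hx' : ¬ (x ∈ I → pairMultiplicity s t x = 2) := hx
      rw [Classical.not_imp, pairMultiplicity] at hx'
      by_cases hs' : s x = 0
      · exact Or.inl ⟨hx'.1, hs'⟩
      · refine Or.inr ⟨hx'.1, ?_⟩
        by_contra ht'
        exact hx'.2 (if_pos ⟨hs', ht'⟩)
    · rw [measure_union_null_iff, Measure.add_apply, Measure.add_apply, sμ, sν, tμ, tν, add_zero]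
      exact ⟨rfl, rfl⟩
  · have nz : ∀ ε : ℝ, (X ^ 2 - C ε * X - 1 : ℝ[X]) ≠ 0 := fun ε h => by
      have := congr_arg (eval 0) h
      simp at this
    have nF : ((X ^ 2 - 1) * (X ^ 2 - C 3) : ℝ[X]) ≠ 0 := fun h => by
      have := congr_arg (eval 0) h
      simp at this
    -- A zero of one block's quadratic may carry an atom of that block's measure. It is not a zero
    -- of the other quadratic, so the other measure gives it no mass. Likewise the finitely many
    -- common band points in `zF` have no mass for `μ`.
    have zμ : ν {x | (X ^ 2 - C 1 * X - 1 : ℝ[X]).eval x = 0} = 0 := by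
      refine pν.measure_eq_zero_of_volume ((finite_zeros (nz 1)).measure_zero _) fun x hx hx2 => ?_
      have e₁ : x ^ 2 - x - 1 = 0 := by simpa using hx
      have e₂ : x ^ 2 + x - 1 = 0 := by simpa using hx2
      have e₃ : x = 0 := by linarith
      rw [e₃] at e₁
      norm_num at e₁
    have zν : μ {x | (X ^ 2 - C (-1) * X - 1 : ℝ[X]).eval x = 0} = 0 := by
      refine pμ.measure_eq_zero_of_volume ((finite_zeros (nz _)).measure_zero _) fun x hx hx2 => ?_
      have e₁ : x ^ 2 + x - 1 = 0 := by simpa using hx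
      have e₂ : x ^ 2 - x - 1 = 0 := by simpa using hx2
      have e₃ : x = 0 := by linarith
      rw [e₃] at e₁
      norm_num at e₁
    have zF : μ {x | ((X ^ 2 - 1) * (X ^ 2 - C 3) : ℝ[X]).eval x = 0} = 0 := by
      refine pμ.measure_eq_zero_of_volume ((finite_zeros nF).measure_zero _) fun x hx hx2 => ?_
      have e₁ : (x ^ 2 - 1) * (x ^ 2 - 3) = 0 := by simpa using hx
      have e₂ : x ^ 2 - x - 1 = 0 := by simpa using hx2
      have e₄ : x * (x - 2) = 0 := by
        linear_combination e₁ - (x ^ 2 + x - 3) * e₂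
      rcases mul_eq_zero.1 e₄ with h | h
      · rw [h] at e₂
        norm_num at e₂
      · rw [sub_eq_zero.1 h] at e₂
        norm_num at e₂
    have gμ := pμ.ae_discriminant_mem
    have gν := pν.ae_discriminant_mem
    set N₁ : Set ℝ := {x | ¬ ((X ^ 2 - C 1 * X - 1 : ℝ[X]).eval x = 0 ∨
        (octagonDiscriminant 1).eval x ∈ Icc (-2 : ℝ) 2)} ∪
      ({x | (X ^ 2 - C (-1) * X - 1 : ℝ[X]).eval x = 0} ∪
        {x | ((X ^ 2 - 1) * (X ^ 2 - C 3) : ℝ[X]).eval x = 0}) with hN₁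
    set N₂ : Set ℝ := {x | ¬ ((X ^ 2 - C (-1) * X - 1 : ℝ[X]).eval x = 0 ∨
        (octagonDiscriminant (-1)).eval x ∈ Icc (-2 : ℝ) 2)} ∪
      {x | (X ^ 2 - C 1 * X - 1 : ℝ[X]).eval x = 0} with hN₂
    have n₁ : μ N₁ = 0 := measure_union_null gμ (measure_union_null zν zF)
    have n₂ : ν N₂ = 0 := measure_union_null gν zμ
    refine measure_mono_null ?_ (measure_union_null
      (measure_inter_eq_zero_of_density hsμ hs n₁) (measure_inter_eq_zero_of_density htν ht n₂))
    intro x hx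
    have hx' : ¬ (x ∈ Iᶜ → pairMultiplicity s t x = 1) := hx
    rw [Classical.not_imp, pairMultiplicity] at hx'
    obtain ⟨hxI, hm⟩ := hx'
    have hst : s x ≠ 0 ∧ t x ≠ 0 := by
      by_contra h
      exact hm (if_neg h)
    by_contra hcon
    rw [mem_union, not_or] at hcon
    have m₁ : x ∉ N₁ := fun h => hcon.1 ⟨h, hst.1⟩
    have m₂ : x ∉ N₂ := fun h => hcon.2 ⟨h, hst.2⟩
    rw [hN₁, mem_union, mem_union, not_or, not_or] at m₁
    rw [hN₂, mem_union, not_or] at m₂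
    obtain ⟨g₁, z₂, f₀⟩ := m₁
    obtain ⟨g₂, z₁⟩ := m₂
    have d₁ := (not_not.1 g₁).resolve_left z₁
    have d₂ := (not_not.1 g₂).resolve_left z₂
    rw [eval_octagonDiscriminant] at d₁ d₂
    rcases mem_of_octagon_discriminants_mem (x := x)
      ⟨by linarith [d₁.1], by linarith [d₁.2]⟩ ⟨by linarith [d₂.1], by linarith [d₂.2]⟩ with h | h
    · exact hxI h
    · exact f₀ (by simpa using h)

end Multiplicity

/-! ### Decaying solutions and eigenvalues -/

section PointSpectrum

open Polynomial Filter
open scoped InnerProductSpace Topology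

/-- A solution of the eigenvalue equation of the half-line Jacobi matrix with diagonal `V`. -/
structure IsJacobiSolution (V : ℕ → ℝ) (z : ℂ) (g : ℕ → ℂ) : Prop where
  apply_one : g 1 = (z - V 0) * g 0
  apply_add_two : ∀ n, g (n + 2) = (z - V (n + 1)) * g (n + 1) - g n

namespace IsJacobiSolution

variable {V : ℕ → ℝ} {z : ℂ} {g : ℕ → ℂ}

theorem eq_zero (h : IsJacobiSolution V z g) (h0 : g 0 = 0) (n : ℕ) : g n = 0 := by
  induction n using Nat.twoStepInduction with
  | zero => exact h0
  | one => rw [h.apply_one, h0, mul_zero]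
  | more n ih1 ih2 => rw [h.apply_add_two, ih1, ih2, mul_zero, sub_zero]

/-- The Casoratian of `g` and its translate by one period does not depend on `n`. It starts at `-(g
0 * g r)` and tends to `0` because `g` does. -/
theorem apply_period (h : IsJacobiSolution V z g) {r : ℕ} (hV : ∀ n, V (n + (r + 1)) = V n)
    (hg : Tendsto g atTop (𝓝 0)) : g 0 * g r = 0 := by
  have hW : ∀ n, g n * g (n + (r + 1) + 1) - g (n + 1) * g (n + (r + 1)) = -(g 0 * g r) := by
    intro n
    induction n with
    | zero =>
      have e := h.apply_add_two r
      have hV0 : V (r + 1) = V 0 := by rw [← hV 0, zero_add]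
      rw [hV0] at e
      rw [zero_add, zero_add, e, h.apply_one]
      ring
    | succ n ih =>
      have e := h.apply_add_two (n + (r + 1))
      have hVn : V (n + (r + 1) + 1) = V (n + 1) := by rw [← hV (n + 1)]; congr 1; ring
      rw [hVn] at e
      rw [← ih, show n + 1 + (r + 1) = n + (r + 1) + 1 by ring, h.apply_add_two n, e]
      ring
  have hs : ∀ k, Tendsto (fun n => g (n + k)) atTop (𝓝 0) :=
    fun k => (tendsto_add_atTop_iff_nat k).2 hg
  have hlim : Tendsto (fun n => g n * g (n + (r + 1 + 1)) - g (n + 1) * g (n + (r + 1))) atTop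
      (𝓝 (0 * 0 - 0 * 0)) := (hg.mul (hs _)).sub ((hs _).mul (hs _))
  have hlim2 : Tendsto (fun _ : ℕ => -(g 0 * g r)) atTop (𝓝 (0 * 0 - 0 * 0)) :=
    hlim.congr fun n => hW n
  have := tendsto_nhds_unique hlim2 tendsto_const_nhds
  simpa using this.symm

/-- When `g r = 0`, the translate of `g` by a period satisfies the same boundary condition, so it is
`g` times `g (r+1) / g 0`; decay forces this factor to have modulus less than `1`. -/
theorem norm_apply_period_lt (h : IsJacobiSolution V z g) {r : ℕ}
    (hV : ∀ n, V (n + (r + 1)) = V n) (hg : Tendsto g atTop (𝓝 0)) (h0 : g 0 ≠ 0) (hr : g r = 0) :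
    ‖g (r + 1)‖ < ‖g 0‖ := by
  have hshift : ∀ k, g 0 * g (k + (r + 1)) = g (r + 1) * g k := by
    intro k
    induction k using Nat.twoStepInduction with
    | zero => rw [zero_add, mul_comm]
    | one =>
      have e := h.apply_add_two r
      have hV0 : V (r + 1) = V 0 := by rw [← hV 0, zero_add]
      rw [hV0, hr, sub_zero] at e
      rw [show 1 + (r + 1) = r + 2 by ring, e, h.apply_one]
      ring
    | more k ih1 ih2 =>
      have e := h.apply_add_two (k + (r + 1))
      have hVn : V (k + (r + 1) + 1) = V (k + 1) := by rw [← hV (k + 1)]; congr 1; ring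
      rw [hVn] at e
      rw [show k + 2 + (r + 1) = k + (r + 1) + 2 by ring, e, h.apply_add_two k]
      rw [show k + 1 + (r + 1) = k + (r + 1) + 1 by ring] at ih2
      linear_combination (z - V (k + 1)) * ih2 - ih1
  have hpow : ∀ k : ℕ, g ((r + 1) * k) = (g (r + 1) / g 0) ^ k * g 0 := by
    intro k
    induction k with
    | zero => simp
    | succ k ih =>
      have := hshift ((r + 1) * k)
      rw [show (r + 1) * k + (r + 1) = (r + 1) * (k + 1) by ring, ih] at this
      refine mul_left_cancel₀ h0 (this.trans ?_)
      rw [pow_succ]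
      field_simp
  have hlim : Tendsto (fun k => g ((r + 1) * k)) atTop (𝓝 0) :=
    hg.comp (tendsto_id.const_mul_atTop' (Nat.succ_pos r))
  have hlim2 : Tendsto (fun k : ℕ => (g (r + 1) / g 0) ^ k) atTop (𝓝 0) := by
    have := (hlim.congr hpow).mul_const (g 0)⁻¹
    rw [zero_mul] at this
    refine this.congr fun k => ?_
    rw [mul_assoc, mul_inv_cancel₀ h0, mul_one]
  have := tendsto_pow_atTop_nhds_zero_iff_norm_lt_one.1 hlim2
  rwa [norm_div, div_lt_one (norm_pos_iff.2 h0)] at this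

end IsJacobiSolution

theorem simonLadderOperator_apply_zero (Λ : Set ℕ) (f : EllTwo (ℕ × Bool)) (b : Bool) :
    simonLadderOperator Λ f (0, b) = f (1, b) + (ladderPotential Λ 1 0 : ℂ) * f (0, !b) := by
  classical
  rw [simonLadderOperator, adjacencyOperator_apply, sum_neighborFinset_simonLadder_zero,
    ladderPotential, zero_add]
  split_ifs <;> simp

theorem simonLadderOperator_apply_succ (Λ : Set ℕ) (f : EllTwo (ℕ × Bool)) (n : ℕ) (b : Bool) :
    simonLadderOperator Λ f (n + 1, b)
      = f (n + 2, b) + (ladderPotential Λ 1 (n + 1) : ℂ) * f (n + 1, !b) + f (n, b) := by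
  classical
  rw [simonLadderOperator, adjacencyOperator_apply, sum_neighborFinset_simonLadder_succ,
    ladderPotential]
  split_ifs <;> simp

theorem ladderPotential_eq_mul (Λ : Set ℕ) (ε : ℝ) (n : ℕ) :
    ladderPotential Λ ε n = ε * ladderPotential Λ 1 n := by
  rw [ladderPotential, ladderPotential]
  split_ifs <;> simp

theorem isJacobiSolution_of_eigenvector {Λ : Set ℕ} {f : EllTwo (ℕ × Bool)} {z : ℂ}
    (hf : simonLadderOperator Λ f = z • f) {ε : ℝ} (hε : ε ^ 2 = 1) :
    IsJacobiSolution (ladderPotential Λ ε) z fun n => f (n, false) + ε * f (n, true) := by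
  have hε' : (ε : ℂ) ^ 2 = 1 := by exact_mod_cast hε
  have hv : ∀ v, simonLadderOperator Λ f v = z * f v := fun v => by rw [hf]; rfl
  refine ⟨?_, fun n => ?_⟩
  · have e₁ := (simonLadderOperator_apply_zero Λ f false).symm.trans (hv _)
    have e₂ := (simonLadderOperator_apply_zero Λ f true).symm.trans (hv _)
    rw [Bool.not_false] at e₁
    rw [Bool.not_true] at e₂
    rw [ladderPotential_eq_mul]
    push_cast
    linear_combination e₁ + ε * e₂ + (ladderPotential Λ 1 0 : ℂ) * f (0, true) * hε'
  · have e₁ := (simonLadderOperator_apply_succ Λ f n false).symm.trans (hv _)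
    have e₂ := (simonLadderOperator_apply_succ Λ f n true).symm.trans (hv _)
    rw [Bool.not_false] at e₁
    rw [Bool.not_true] at e₂
    rw [ladderPotential_eq_mul]
    push_cast
    linear_combination e₁ + ε * e₂ + (ladderPotential Λ 1 (n + 1) : ℂ) * f (n + 1, true) * hε'

theorem tendsto_ladder_coefficient (f : EllTwo (ℕ × Bool)) (b : Bool) :
    Tendsto (fun n => f (n, b)) atTop (𝓝 0) := by
  have h := (lp.memℓp f).summable (by simp)
  have h1 : Tendsto (fun v => ‖f v‖ ^ (2 : ℝ≥0∞).toReal) cofinite (𝓝 0) :=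
    h.tendsto_cofinite_zero
  have h2 : Tendsto (fun n : ℕ => ‖f (n, b)‖ ^ (2 : ℝ≥0∞).toReal) atTop (𝓝 0) := by
    rw [← Nat.cofinite_eq_atTop]
    exact h1.comp (Function.Injective.tendsto_cofinite fun m n hmn => (Prod.mk.inj hmn).1)
  rw [tendsto_zero_iff_norm_tendsto_zero]
  have h3 := (Real.continuous_sqrt.tendsto 0).comp h2
  rw [Real.sqrt_zero] at h3
  refine h3.congr fun n => ?_
  simp [Real.sqrt_sq]

/-- A solution with `g 0 = 0` is zero, and an eigenvector whose symmetric and antisymmetric parts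
both vanish is zero. -/
theorem exists_jacobiSolution_of_mem_pointSpectrum {Λ : Set ℕ} {z : ℂ}
    (hz : z ∈ pointSpectrum (simonLadderOperator Λ)) :
    ∃ ε : ℝ, ε ^ 2 = 1 ∧ ∃ g, IsJacobiSolution (ladderPotential Λ ε) z g ∧
      Tendsto g atTop (𝓝 0) ∧ g 0 ≠ 0 := by
  obtain ⟨f, hf⟩ := Module.End.HasEigenvalue.exists_hasEigenvector hz
  have hfz : simonLadderOperator Λ f = z • f := hf.apply_eq_smul
  have hlim : ∀ ε : ℝ, Tendsto (fun n => f (n, false) + ε * f (n, true)) atTop (𝓝 0) := by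
    intro ε
    have := (tendsto_ladder_coefficient f false).add
      ((tendsto_ladder_coefficient f true).const_mul (ε : ℂ))
    simpa using this
  by_contra! hcon
  have hzero : ∀ ε : ℝ, ε ^ 2 = 1 → ∀ n, f (n, false) + ε * f (n, true) = 0 := by
    intro ε hε n
    have hs := isJacobiSolution_of_eigenvector hfz hε
    exact hs.eq_zero (hcon ε hε _ hs (hlim ε)) n
  refine hf.2 (eq_zero_of_inner_ladderVector (fun n => ?_) fun n => ?_)
  · rw [inner_ladderVector, hzero 1 (by norm_num), mul_zero]
  · rw [inner_ladderVector, hzero (-1) (by norm_num), mul_zero]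

/-- If `g 1 = 0` then `g 2 = -g 0`, which contradicts strict decay over a period. -/
theorem hexagon_pointSpectrum : pointSpectrum (simonLadderOperator hexagonRungs) = ∅ := by
  rw [eq_empty_iff_forall_notMem]
  intro z hz
  obtain ⟨ε, -, g, hg, hlim, h0⟩ := exists_jacobiSolution_of_mem_pointSpectrum hz
  have hV : ∀ n, ladderPotential hexagonRungs ε (n + (1 + 1)) = ladderPotential hexagonRungs ε n :=
    fun n => by simp only [hexagonPotential_eq, Nat.add_mod_right, Nat.reduceAdd]
  have h1 := (mul_eq_zero.1 (hg.apply_period hV hlim)).resolve_left h0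
  have h2 := hg.norm_apply_period_lt hV hlim h0 h1
  have h3 := hg.apply_add_two 0
  rw [zero_add, h1, mul_zero, zero_sub] at h3
  rw [show 1 + 1 = 2 from rfl, h3, norm_neg] at h2
  exact lt_irrefl _ h2

/-- The condition `g 2 = 0` reads `z (z - ε) = 1`, and `g 3 = -(z - ε) g 0` adds `|z - ε| < 1`,
which selects one of the two roots. -/
theorem octagon_pointSpectrum_subset {z : ℂ}
    (hz : z ∈ pointSpectrum (simonLadderOperator octagonRungs)) :
    ∃ ε : ℝ, ε ^ 2 = 1 ∧ z = ((ε * ((1 + √5) / 2) : ℝ) : ℂ) := by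
  obtain ⟨ε, hε, g, hg, hlim, h0⟩ := exists_jacobiSolution_of_mem_pointSpectrum hz
  refine ⟨ε, hε, ?_⟩
  have hV : ∀ n, ladderPotential octagonRungs ε (n + (2 + 1)) = ladderPotential octagonRungs ε n :=
    fun n => by simp only [octagonPotential_eq, Nat.add_mod_right, Nat.reduceAdd]
  have h2 := (mul_eq_zero.1 (hg.apply_period hV hlim)).resolve_left h0
  have h3 := hg.norm_apply_period_lt hV hlim h0 h2
  have e1 := hg.apply_one
  have e2 := hg.apply_add_two 0
  have e3 := hg.apply_add_two 1
  rw [octagonPotential_eq, if_pos rfl] at e1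
  rw [zero_add, zero_add, octagonPotential_eq, if_neg (by norm_num), Complex.ofReal_zero, sub_zero,
    h2, e1] at e2
  rw [show 1 + 2 = 2 + 1 from rfl, show 1 + 1 = 2 from rfl, h2, mul_zero, zero_sub, e1] at e3
  rw [e3, norm_neg, norm_mul, mul_lt_iff_lt_one_left (norm_pos_iff.2 h0)] at h3
  have hq : z * (z - ε) = 1 := by
    refine mul_right_cancel₀ h0 ?_
    linear_combination -e2
  have hε' : (ε : ℂ) ^ 2 = 1 := by exact_mod_cast hε
  have h5 : √5 ^ 2 = 5 := Real.sq_sqrt (by norm_num)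
  have h5' : ((√5 : ℝ) : ℂ) ^ 2 = 5 := by exact_mod_cast h5
  have h5'' : 2 < √5 := by rw [Real.lt_sqrt (by norm_num)]; norm_num
  have hfac : (z - ε * ((1 + (√5 : ℝ)) / 2)) * (z - ε * ((1 - (√5 : ℝ)) / 2)) = 0 := by
    linear_combination hq + (1 - (√5 : ℝ) ^ 2) / 4 * hε' - h5' / 4
  rcases mul_eq_zero.1 hfac with h | h
  · rw [sub_eq_zero.1 h]
    push_cast
    ring
  -- At the conjugate root `|z - ε| = (1 + √5) / 2 > 1`.
  · exfalso
    have habs : |ε| = 1 := by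
      rcases mul_self_eq_one_iff.1 ((sq ε).symm.trans hε) with h' | h' <;> simp [h']
    have hz' : z - ε = ((-(ε * ((1 + √5) / 2)) : ℝ) : ℂ) := by
      push_cast
      linear_combination h
    rw [hz', Complex.norm_real, norm_neg, norm_mul, Real.norm_eq_abs, Real.norm_eq_abs,
      habs, one_mul, abs_of_pos (by positivity)] at h3
    linarith

/-- The decaying solution of the octagon at the eigenvalue `ε (1 + √5) / 2`. -/
noncomputable def octagonSolution (ε : ℝ) (n : ℕ) : ℝ :=
  (jacobiPolynomial (ladderPotential octagonRungs ε) n).eval (ε * ((1 + √5) / 2))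

theorem octagonSolution_one (ε : ℝ) : octagonSolution ε 1 =
    (ε * ((1 + √5) / 2) - ladderPotential octagonRungs ε 0) * octagonSolution ε 0 := by
  simp only [octagonSolution, jacobiPolynomial_one, jacobiPolynomial_zero, eval_sub, eval_X,
    eval_C, eval_one, mul_one]

theorem octagonSolution_add_two (ε : ℝ) (n : ℕ) : octagonSolution ε (n + 2) =
    (ε * ((1 + √5) / 2) - ladderPotential octagonRungs ε (n + 1)) * octagonSolution ε (n + 1)
      - octagonSolution ε n := by
  simp only [octagonSolution, jacobiPolynomial_add_two, eval_sub, eval_mul, eval_X, eval_C]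

/-- One period multiplies the solution by `-ε (√5 - 1) / 2`, whose square is at most `27/64 =
(3/4)³`; this allows the rate `3/4` per step. -/
theorem octagonSolution_sq_le {ε : ℝ} (hε : ε ^ 2 = 1) (n : ℕ) :
    octagonSolution ε n ^ 2 ≤ (3 / 4 : ℝ) ^ n := by
  have h5 : √5 ^ 2 = 5 := Real.sq_sqrt (by norm_num)
  have h5' : 11 / 5 < √5 := by rw [Real.lt_sqrt (by norm_num)]; norm_num
  have g0 : octagonSolution ε 0 = 1 := by simp [octagonSolution, jacobiPolynomial_zero]
  have g1 : octagonSolution ε 1 = ε * ((√5 - 1) / 2) := by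
    rw [octagonSolution_one, g0, octagonPotential_eq, if_pos rfl]
    ring
  have g2 : octagonSolution ε 2 = 0 := by
    rw [octagonSolution_add_two, zero_add, g1, g0, octagonPotential_eq, if_neg (by norm_num)]
    linear_combination (√5 ^ 2 - 1) / 4 * hε + h5 / 4
  have hstep : ∀ n, octagonSolution ε (n + 3)
      = -(ε * ((√5 - 1) / 2)) * octagonSolution ε n := by
    intro n
    induction n using Nat.twoStepInduction with
    | zero =>
      rw [show 0 + 3 = 1 + 2 from rfl, octagonSolution_add_two, show 1 + 1 = 2 from rfl, g2, g1, g0]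
      ring
    | one =>
      have e3 : octagonSolution ε (2 + 1) = -(ε * ((√5 - 1) / 2)) := by
        rw [show 2 + 1 = 1 + 2 from rfl, octagonSolution_add_two, show 1 + 1 = 2 from rfl, g2, g1]
        ring
      rw [show 1 + 3 = 2 + 2 from rfl, octagonSolution_add_two, e3, g2, g1, octagonPotential_eq,
        if_pos rfl]
      ring
    | more n ih1 ih2 =>
      rw [show n + 2 + 3 = n + 3 + 2 by ring, octagonSolution_add_two,
        show n + 3 + 1 = n + 1 + 3 by ring, ih1, ih2, octagonSolution_add_two ε n,
        octagonPotential_eq, octagonPotential_eq, Nat.add_mod_right]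
      ring
  have hc : (-(ε * ((√5 - 1) / 2))) ^ 2 ≤ 27 / 64 := by
    have e : (-(ε * ((√5 - 1) / 2))) ^ 2 = ((√5 - 1) / 2) ^ 2 := by
      linear_combination ((√5 - 1) / 2) ^ 2 * hε
    rw [e]
    nlinarith
  induction n using Nat.strong_induction_on with
  | _ n ih =>
    rcases n with _ | _ | _ | n
    · rw [g0]; norm_num
    · rw [zero_add, g1, mul_pow, hε]
      nlinarith
    · rw [zero_add, show 1 + 1 = 2 from rfl, g2]
      norm_num
    · rw [show n + 1 + 1 + 1 = n + 3 from rfl, hstep, mul_pow, pow_add, mul_comm]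
      refine mul_le_mul (ih n (by omega)) (hc.trans (by norm_num)) (sq_nonneg _) (by positivity)

theorem octagon_mem_pointSpectrum {ε : ℝ} (hε : ε ^ 2 = 1) :
    ((ε * ((1 + √5) / 2) : ℝ) : ℂ) ∈ pointSpectrum (simonLadderOperator octagonRungs) := by
  let F : ℕ × Bool → ℂ := fun v => ((octagonSolution ε v.1 * if v.2 then ε else 1 : ℝ) : ℂ)
  have hF : Memℓp F 2 := by
    refine memℓp_gen ?_
    have hs : Summable fun v : ℕ × Bool => (3 / 4 : ℝ) ^ v.1 * (1 : ℝ) :=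
      Summable.mul_of_nonneg (g := fun _ : Bool => (1 : ℝ))
        (summable_geometric_of_lt_one (by norm_num) (by norm_num)) (Summable.of_finite)
        (fun n => by positivity) (fun _ => zero_le_one)
    refine hs.of_nonneg_of_le (fun v => by positivity) fun v => ?_
    rw [show (2 : ℝ≥0∞).toReal = ((2 : ℕ) : ℝ) by simp, Real.rpow_natCast, Complex.norm_real,
      Real.norm_eq_abs, sq_abs, mul_pow]
    refine mul_le_mul (octagonSolution_sq_le hε _) ?_ (sq_nonneg _) (by positivity)
    split_ifs
    · exact hε.le
    · norm_num
  let f : EllTwo (ℕ × Bool) := ⟨F, hF⟩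
  have hfv : ∀ v, f v = F v := fun _ => rfl
  have hε2 : (ε : ℂ) ^ 2 = 1 := by exact_mod_cast hε
  refine Module.End.hasEigenvalue_of_hasEigenvector (x := f) ⟨?_, ?_⟩
  · rw [Module.End.mem_eigenspace_iff]
    show simonLadderOperator octagonRungs f = _
    refine lp.ext (funext ?_)
    rintro ⟨n, b⟩
    show simonLadderOperator octagonRungs f (n, b) = ((ε * ((1 + √5) / 2) : ℝ) : ℂ) * f (n, b)
    rcases n with _ | n
    · have e := congr_arg (fun x : ℝ => (x : ℂ)) (octagonSolution_one ε)
      simp only [ladderPotential_eq_mul octagonRungs ε] at e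
      push_cast at e
      rw [simonLadderOperator_apply_zero, hfv, hfv, hfv]
      cases b
      · simp only [F, Bool.not_false, Bool.false_eq_true, if_true, if_false]
        push_cast
        linear_combination e
      · simp only [F, Bool.not_true, Bool.false_eq_true, if_true, if_false]
        push_cast
        linear_combination ε * e - (ladderPotential octagonRungs 1 0 : ℂ) *
          octagonSolution ε 0 * hε2
    · have e := congr_arg (fun x : ℝ => (x : ℂ)) (octagonSolution_add_two ε n)
      simp only [ladderPotential_eq_mul octagonRungs ε] at e
      push_cast at e
      rw [simonLadderOperator_apply_succ, hfv, hfv, hfv, hfv]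
      cases b
      · simp only [F, Bool.not_false, Bool.false_eq_true, if_true, if_false]
        push_cast
        linear_combination e
      · simp only [F, Bool.not_true, Bool.false_eq_true, if_true, if_false]
        push_cast
        linear_combination ε * e - (ladderPotential octagonRungs 1 (n + 1) : ℂ) *
          octagonSolution ε (n + 1) * hε2
  · intro h0
    have h1 : f (0, false) = 0 := by rw [h0]; rfl
    rw [hfv] at h1
    simp [F, octagonSolution, jacobiPolynomial_zero] at h1

theorem octagon_pointSpectrum : pointSpectrum (simonLadderOperator octagonRungs)
    = (fun x : ℝ => (x : ℂ)) '' {(1 + √5) / 2, -((1 + √5) / 2)} := by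
  ext z
  constructor
  · intro hz
    obtain ⟨ε, hε, rfl⟩ := octagon_pointSpectrum_subset hz
    refine ⟨_, ?_, rfl⟩
    rcases mul_self_eq_one_iff.1 ((sq ε).symm.trans hε) with rfl | rfl
    · left; ring
    · right; rw [mem_singleton_iff]; ring
  · rintro ⟨x, rfl | rfl, rfl⟩
    · have := octagon_mem_pointSpectrum (ε := 1) (by norm_num)
      rwa [one_mul] at this
    · have := octagon_mem_pointSpectrum (ε := -1) (by norm_num)
      rwa [neg_one_mul] at this

end PointSpectrum

/-! ### Assembly of the hexagon and octagon statements -/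

theorem mainTheorem9 :
    -- the infinite linear hexagon: rungs at the positions 1, 3, 5, …
    (spectrum ℂ (simonLadderOperator (Set.range fun j : ℕ => 2 * j + 1)) =
        (fun x : ℝ => (x : ℂ)) '' Set.Icc ((-1 - √17) / 2) ((1 + √17) / 2) ∧
      essentialSpectrum (simonLadderOperator (Set.range fun j : ℕ => 2 * j + 1)) =
        (fun x : ℝ => (x : ℂ)) '' Set.Icc ((-1 - √17) / 2) ((1 + √17) / 2) ∧
      pointSpectrum (simonLadderOperator (Set.range fun j : ℕ => 2 * j + 1)) = ∅) ∧
    -- the infinite linear octagon: rungs at the positions 1, 4, 7, …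
    (spectrum ℂ (simonLadderOperator (Set.range fun j : ℕ => 3 * j + 1)) =
        (fun x : ℝ => (x : ℂ)) '' (Set.Icc (-1 - √2) (1 + √2) ∪
          {(1 + √5) / 2, -((1 + √5) / 2)}) ∧
      pointSpectrum (simonLadderOperator (Set.range fun j : ℕ => 3 * j + 1)) =
        (fun x : ℝ => (x : ℂ)) '' {(1 + √5) / 2, -((1 + √5) / 2)} ∧
      HasSpectralMultiplicityOn (simonLadderOperator (Set.range fun j : ℕ => 3 * j + 1)) 2
        (Set.Icc (1 - √2) (√2 - 1)) ∧
      HasSpectralMultiplicityOn (simonLadderOperator (Set.range fun j : ℕ => 3 * j + 1)) 1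
        (Set.Icc (1 - √2) (√2 - 1))ᶜ) := by
  have hhex := (simonLadder_spectrum_complex hexagonRungs).trans
    (congr_arg _ hexagon_spectrum_real)
  -- Without eigenvalues there is no discrete spectrum, so the essential spectrum is the whole
  -- spectrum.
  have hdisc : discreteSpectrum (simonLadderOperator hexagonRungs) = ∅ := by
    rw [eq_empty_iff_forall_notMem]
    rintro z ⟨hz, -⟩
    rw [hexagon_pointSpectrum] at hz
    exact hz
  refine ⟨⟨hhex, ?_, hexagon_pointSpectrum⟩, ?_, octagon_pointSpectrum,
    octagon_multiplicity (Or.inl ⟨rfl, rfl⟩), octagon_multiplicity (Or.inr ⟨rfl, rfl⟩)⟩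
  · rw [essentialSpectrum, hdisc, sdiff_empty, hhex]
  -- The two eigenvalues already lie in the interval, so the union adds nothing.
  · rw [simonLadder_spectrum_complex, octagon_spectrum_real, union_eq_left.2]
    have h5 : √5 < 3 := by rw [Real.sqrt_lt' (by norm_num)]; norm_num
    have h5' : 0 < √5 := by positivity
    have h2 : 1 < √2 := by rw [Real.lt_sqrt (by norm_num)]; norm_num
    rintro x (rfl | rfl)
    · constructor <;> linarith
    · constructor <;> linarith
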